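/- **Theorem 2.4.** Fix a real number $\alpha>0$. On the doubly slit plane $\mathcal H=\mathbb C\setminus\big((-\infty,-\tfrac{\pi}{2})\cup(\tfrac{\pi}{2},\infty)\big)$ put $$F(x)=\int_{-\pi/2}^{x}(\cos y)^{\alpha}\,dy ,$$ the integral being taken along any contour in $\mathcal H$ from $-\pi/2$ to $x$, where powers of the cosine are $(\cos y)^{s}=e^{s\operatorname{Log}\cos y}$ with the branch equal to $1$ at $y=0$. For $\nu,\kappa\in\mathbb C$ with $\nu-\kappa\in\{0,1,2,\dots\}$ define $$A[\nu,\kappa]=\frac{\alpha^{\nu-\kappa+1}}{(\nu-\kappa)!}\cdot\frac{\Gamma(\nu+1)}{2\pi i}\int_{-i\infty}^{+i\infty}(\cos x)^{-\alpha\nu}F(x)^{\nu-\kappa}\,dx\qquad(\operatorname{Re}\kappa>0),$$ $$B\{\nu,\kappa\}=\frac{\alpha^{\nu-\kappa}}{\Gamma(\kappa)\,(\nu-\kappa)!}\int_{-\pi/2}^{\pi/2}(\cos x)^{\alpha\kappa}F(x)^{\nu-\kappa}\,dx\qquad(\operatorname{Re}\kappa>-1/\alpha).$$ For every fixed value of $\nu-\kappa\in\{0,1,2,\dots\}$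 these functions of $\kappa$ extend to meromorphic functions on $\mathbb C$, again denoted by $A[\nu,\kappa]$ and $B\{\nu,\kappa\}$. Let $n,d,k\in\mathbb C$ be such that $n-d$ and $d-k$ are fixed, but arbitrary, non-negative integers. Then the following equalities of meromorphic functions of the complex variable $k$ (equivalently, $n$) hold: $$\sum_{\substack{s=0,2,4,\dots\\ s\le d-k,\ m:=d-s}} B\{n,m\}\,\frac{(m+\frac1\alpha)\Gamma(m)}{\Gamma(m+1+\frac2\alpha)}\,A\!\left[m+\tfrac2\alpha,k+\tfrac2\alpha\right]=\sum_{\substack{q=0,2,4,\dots\\ q\le d-k}} B\!\left\{n-\tfrac q\alpha,\,d-q-\tfrac q\alpha\right\}A\!\left[d-q-\tfrac q\alpha,\,k-\tfrac q\alpha\right],$$ $$\sum_{\substack{s=2,4,6,\dots\\ s\le n-d,\ m:=d+s}} B\{n,m\}\,\frac{(m+\frac1\alpha)\Gamma(m)}{\Gamma(m+1+\frac2\alpha)}\,A\!\left[m+\tfrac2\alpha,k+\tfrac2\alpha\right]=\sum_{\substack{q=2,4,6,\dots\\ q\le n-d}} B\!\left\{n+\tfrac q\alpha,\,d+q+\tfrac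 q\alpha\right\}A\!\left[d+q+\tfrac q\alpha,\,k+\tfrac q\alpha\right].$$ -/

import Mathlib

open Filter Set

noncomputable section

namespace BetaPolytope

/-- The branch of `Log (cos x)` on the doubly slit plane
`ℂ \ ((-∞, -π/2) ∪ (π/2, ∞))` that vanishes at `x = 0` (for `x ≠ ±π/2`): the primitive of `-tan`
starting at `0`, computed along the straight segment from `0` to `x`. -/
def logCos (x : ℂ) : ℂ :=
  -∫ t in (0 : ℝ)..1, x * Complex.tan ((t : ℂ) * x)

open Classical in
/-- `(cos x) ^ s = exp (s * Log (cos x))`, with the branch that equals `1` at `x = 0`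
(and the value `0` at the two branch points `±π/2`, where `cos x = 0`). -/
def cosPow (s x : ℂ) : ℂ :=
  if Complex.cos x = 0 then 0 else Complex.exp (s * logCos x)

/-- `F x = ∫_{-π/2}^x (cos y) ^ α dy`, integrated along the contour in the doubly slit plane
that goes straight from `-π/2` to `0` and then straight from `0` to `x`. -/
def F (α : ℝ) (x : ℂ) : ℂ :=
  (∫ y in (-(Real.pi / 2))..(0 : ℝ), cosPow α (y : ℂ)) +
    ∫ t in (0 : ℝ)..1, x * cosPow α ((t : ℂ) * x)

/-- The integral formula for `A[ν, κ]`, where `ν = κ + j`; it is meant for `Re κ > 0`.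
The integral over the imaginary axis is parametrized by `x = i y`, `dx = i dy`. -/
def integralA (α : ℝ) (j : ℕ) (κ : ℂ) : ℂ :=
  (α : ℂ) ^ (j + 1) / (j.factorial : ℂ) *
    (Complex.Gamma (κ + j + 1) / (2 * Real.pi * Complex.I)) *
    ∫ y : ℝ, cosPow (-(α * (κ + j))) (Complex.I * y) * F α (Complex.I * y) ^ j * Complex.I

/-- The integral formula for `B{ν, κ}`, where `ν = κ + j`; it is meant for `Re κ > -1/α`. -/
def integralB (α : ℝ) (j : ℕ) (κ : ℂ) : ℂ :=
  (α : ℂ) ^ j / (Complex.Gamma κ * (j.factorial : ℂ)) *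
    ∫ x in (-(Real.pi / 2))..(Real.pi / 2), cosPow (α * κ) (x : ℂ) * F α (x : ℂ) ^ j

open Classical in
/-- The meromorphic continuation to `ℂ` of the restriction of `f` to `U`, if there is one,
with removable singularities removed (and the value `0` at the poles). By the identity theorem
it is unique when `U` is open and non-empty. -/
def meromorphicContinuation (f : ℂ → ℂ) (U : Set ℂ) : ℂ → ℂ :=
  if h : ∃ g : ℂ → ℂ, MeromorphicNFOn g univ ∧ EqOn g f U then h.choose else 0

open Classical in
/-- The quantity `A[ν, κ]` for `ν - κ ∈ ℤ`: zero if `ν - κ` is negative, and for fixed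
`ν - κ = j ∈ ℕ` the meromorphic continuation in `κ` of its integral formula. -/
def A (α : ℝ) (ν κ : ℂ) : ℂ :=
  if h : ∃ j : ℕ, ν - κ = j then
    meromorphicContinuation (integralA α h.choose) {z | 0 < z.re} κ
  else 0

open Classical in
/-- The quantity `B{ν, κ}` for `ν - κ ∈ ℤ`: zero if `ν - κ` is negative, and for fixed
`ν - κ = j ∈ ℕ` the meromorphic continuation in `κ` of its integral formula. -/
def B (α : ℝ) (ν κ : ℂ) : ℂ :=
  if h : ∃ j : ℕ, ν - κ = j then
    meromorphicContinuation (integralB α h.choose) {z | -(1 / α) < z.re} κ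
  else 0

end BetaPolytope

end

/-!
Write `f ^ [j] = F ^ j / j!`, read as `0` for `j < 0`, so that the integrals of `cos ^ w * f ^ [j]`
over `(-π/2, π/2)` and over the imaginary axis are `B` and `A` up to explicit factors. The function
`(w + α + 1) * cos ^ w * sin * f ^ [j] + cos ^ (w + α + 1) * f ^ [j - 1]` has a derivative which is
a combination of `cos ^ (w + 1) * f ^ [j]`, `cos ^ (w - 1) * f ^ [j]` and
`cos ^ (w + 2 * α + 1) * f ^ [j - 2]`, and it vanishes at the ends of both contours. Hence both
families of integrals satisfy the same three-term recurrence, which also continues them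
meromorphically. Applied to either factor of a left-hand summand, the recurrence turns it into
one of two neighbouring right-hand summands plus a defect. A triangular array of such relations
joins the two sums: inner defects cancel in pairs, and the ones on the boundary contain a negative
divided power. The integrals are defined when `Re k` is large, and the identity theorem does
the rest.
-/

noncomputable section

namespace BetaPolytope

open MeasureTheory Topology
open scoped ComplexOrder

section Ladder

variable {M : Type*} [AddCommMonoid M]

theorem ladder_row {e d g g' : ℕ → M} {n : ℕ} (h : ∀ p ≤ n, e p = d p + g' p)
    (h' : ∀ p < n, e (p + 1) = d p + g p) :
    e 0 + ∑ p ∈ Finset.range n, g p = d n + ∑ p ∈ Finset.range (n + 1), g' p := by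
  induction n with
  | zero => simpa using h 0 le_rfl
  | succ n ih =>
    calc e 0 + ∑ p ∈ Finset.range (n + 1), g p
        = d n + ∑ p ∈ Finset.range (n + 1), g' p + g n := by
          rw [Finset.sum_range_succ, ← add_assoc,
            ih (fun p hp => h p (hp.trans n.le_succ)) fun p hp => h' p (hp.trans n.lt_succ_self)]
      _ = e (n + 1) + ∑ p ∈ Finset.range (n + 1), g' p := by
          rw [h' n n.lt_succ_self, add_right_comm]
      _ = d (n + 1) + ∑ p ∈ Finset.range (n + 1 + 1), g' p := by
          rw [h (n + 1) le_rfl, Finset.sum_range_succ _ (n + 1), add_assoc, add_comm (g' (n + 1))]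

theorem sum_ladder {E D G : ℕ → ℕ → M} {n : ℕ}
    (h : ∀ σ < n, ∀ p ≤ σ, E σ p = D σ p + G (σ + 1) p)
    (h' : ∀ σ < n, ∀ p < σ, E σ (p + 1) = D σ p + G σ p) :
    ∑ σ ∈ Finset.range n, E σ 0 = ∑ σ ∈ Finset.range n, D σ σ + ∑ p ∈ Finset.range n, G n p := by
  induction n with
  | zero => simp
  | succ n ih =>
    calc ∑ σ ∈ Finset.range (n + 1), E σ 0
        = ∑ σ ∈ Finset.range n, D σ σ + (E n 0 + ∑ p ∈ Finset.range n, G n p) := by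
          rw [Finset.sum_range_succ, ih (fun σ hσ => h σ (hσ.trans n.lt_succ_self))
            fun σ hσ => h' σ (hσ.trans n.lt_succ_self), add_assoc, add_comm (E n 0)]
      _ = ∑ σ ∈ Finset.range (n + 1), D σ σ + ∑ p ∈ Finset.range (n + 1), G (n + 1) p := by
          rw [ladder_row (h n n.lt_succ_self) (h' n n.lt_succ_self), ← add_assoc,
            Finset.sum_range_succ fun σ => D σ σ]

theorem sum_range_filter_even (f : ℕ → M) (K : ℕ) :
    ∑ s ∈ (Finset.range (K + 1)).filter Even, f s =
      ∑ σ ∈ Finset.range (K / 2 + 1), f (2 * σ) := by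
  refine (Finset.sum_nbij' (2 * ·) (· / 2) ?_ ?_ ?_ ?_ fun _ _ => rfl).symm <;>
    simp only [Finset.mem_filter, Finset.mem_range, Nat.even_iff] <;> grind

theorem sum_Icc_filter_even (f : ℕ → M) (N : ℕ) :
    ∑ s ∈ (Finset.Icc 1 N).filter Even, f s =
      ∑ σ ∈ Finset.range (N / 2), f (2 * (σ + 1)) := by
  refine (Finset.sum_nbij' (fun σ => 2 * (σ + 1)) (· / 2 - 1) ?_ ?_ ?_ ?_ fun _ _ => rfl).symm <;>
    simp only [Finset.mem_filter, Finset.mem_range, Finset.mem_Icc, Nat.even_iff] <;> grind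

end Ladder

section Meromorphic

theorem meromorphic_comp_differentiable {f : ℂ → ℂ} {g : ℂ → ℂ} (hf : Meromorphic f)
    (hg : Differentiable ℂ g) : Meromorphic fun z => f (g z) :=
  fun z => (hf (g z)).comp_analyticAt (hg.analyticAt z)

section Field

variable {𝕜 E : Type*} [NontriviallyNormedField 𝕜] [NormedAddCommGroup E] [NormedSpace 𝕜 E]

theorem eventuallyEq_of_preconnected_of_meromorphicOn {f g : 𝕜 → E} {U : Set 𝕜}
    (hf : MeromorphicOn f U) (hg : MeromorphicOn g U) (hU : IsPreconnected U) {z₀ : 𝕜}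
    (h₀ : z₀ ∈ U) (h : f =ᶠ[𝓝[≠] z₀] g) {z : 𝕜} (hz : z ∈ U) : f =ᶠ[𝓝[≠] z] g := by
  have order_top {x : 𝕜} : meromorphicOrderAt (f - g) x = ⊤ ↔ f =ᶠ[𝓝[≠] x] g := by
    simp only [meromorphicOrderAt_eq_top_iff, Pi.sub_apply, sub_eq_zero, EventuallyEq]
  contrapose! h
  rw [← order_top] at h ⊢
  exact (hf.sub hg).meromorphicOrderAt_ne_top_of_isPreconnected hU hz h₀ h

theorem exists_meromorphic_eqOn_of_cover {Φ : ℕ → 𝕜 → E} {U : ℕ → Set 𝕜}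
    (hU : ∀ n, IsOpen (U n)) (hmono : Monotone U) (hcover : ∀ z, ∃ n, z ∈ U n)
    (hΦ : ∀ n, MeromorphicOn (Φ n) (U n)) (hstep : ∀ n, EqOn (Φ (n + 1)) (Φ n) (U n)) :
    ∃ g : 𝕜 → E, Meromorphic g ∧ ∀ n, EqOn g (Φ n) (U n) := by
  have compat {m n : ℕ} (hmn : m ≤ n) : EqOn (Φ n) (Φ m) (U m) := by
    induction n, hmn using Nat.le_induction with
    | base => exact eqOn_refl _ _
    | succ n hmn ih => exact ((hstep n).mono (hmono hmn)).trans ih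
  choose ν hν using hcover
  have hg (n : ℕ) : EqOn (fun z => Φ (ν z) z) (Φ n) (U n) := fun z hz =>
    (le_total n (ν z)).elim (compat · hz) fun h => (compat h (hν z)).symm
  exact ⟨fun z => Φ (ν z) z, fun z => (hΦ (ν z)).congr (hg (ν z)).symm (hU (ν z)) z (hν z), hg⟩

end Field

theorem isOpen_re_gt (c : ℝ) : IsOpen {z : ℂ | c < z.re} :=
  isOpen_lt continuous_const Complex.continuous_re

theorem eventually_codiscrete_eq_of_re_gt {f g : ℂ → ℂ} (hf : Meromorphic f)
    (hg : Meromorphic g) {c : ℝ} (h : ∀ z : ℂ, c < z.re → f z = g z) :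
    f =ᶠ[codiscrete ℂ] g := by
  have h₀ : f =ᶠ[𝓝[≠] ((c + 1 : ℝ) : ℂ)] g :=
    (eventually_of_mem ((isOpen_re_gt c).mem_nhds (by simp)) h).filter_mono nhdsWithin_le_nhds
  refine mem_codiscrete.2 fun z => disjoint_principal_right.2 ?_
  rw [compl_compl]
  exact eventuallyEq_of_preconnected_of_meromorphicOn hf.meromorphicOn hg.meromorphicOn
    isPreconnected_univ (mem_univ _) h₀ (mem_univ z)

theorem meromorphicContinuation_spec {f g : ℂ → ℂ} {U : Set ℂ} (hU : IsOpen U)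
    (hU' : IsPreconnected U) (hf : DifferentiableOn ℂ f U) (hg : Meromorphic g) {z₀ : ℂ}
    (h₀ : z₀ ∈ U) (h : g =ᶠ[𝓝 z₀] f) :
    Meromorphic (meromorphicContinuation f U) ∧ EqOn (meromorphicContinuation f U) f U := by
  have analytic : AnalyticOnNhd ℂ f U := hf.analyticOnNhd hU
  have exists_ext : ∃ g : ℂ → ℂ, MeromorphicNFOn g univ ∧ EqOn g f U := by
    refine ⟨toMeromorphicNFOn g univ, meromorphicNFOn_toMeromorphicNFOn g univ, fun z hz => ?_⟩
    have hgf : g =ᶠ[𝓝[≠] z] f :=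
      eventuallyEq_of_preconnected_of_meromorphicOn hg.meromorphicOn analytic.meromorphicOn hU'
        h₀ (h.filter_mono nhdsWithin_le_nhds) hz
    calc toMeromorphicNFOn g univ z = toMeromorphicNFAt g z z :=
          toMeromorphicNFOn_eq_toMeromorphicNFAt hg.meromorphicOn (mem_univ z)
      _ = toMeromorphicNFAt f z z := (toMeromorphicNFAt_eventuallyEq_nhds_congr hgf).eq_of_nhds
      _ = f z := by rw [toMeromorphicNFAt_eq_self.2 (analytic z hz).meromorphicNFAt]
  rw [meromorphicContinuation, dif_pos exists_ext]
  exact ⟨meromorphicOn_univ.1 exists_ext.choose_spec.1.meromorphicOn, exists_ext.choose_spec.2⟩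

theorem exists_meromorphic_extension_of_difference_eq {f R S : ℂ → ℂ} {c δ : ℝ} (hδ : 0 < δ)
    (hR : Meromorphic R) (hS : Meromorphic S) (hf : MeromorphicOn f {z | c < z.re})
    (h : ∀ z : ℂ, c < z.re → f z = R z * f (z + δ) + S z) :
    ∃ g : ℂ → ℂ, Meromorphic g ∧ EqOn g f {z | c < z.re} := by
  let Φ (n : ℕ) : ℂ → ℂ := (fun φ z => R z * φ (z + δ) + S z)^[n] f
  let U (n : ℕ) : Set ℂ := {z | c - n * δ < z.re}
  have mem_U {n : ℕ} {z : ℂ} : z ∈ U n ↔ c < z.re + n * δ :=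
    mem_ofPred.trans sub_lt_iff_lt_add
  have Φ_succ (n : ℕ) (z : ℂ) : Φ (n + 1) z = R z * Φ n (z + δ) + S z := by
    simp only [Φ, Function.iterate_succ_apply']
  have shift {n : ℕ} {z : ℂ} (hz : z ∈ U (n + 1)) : z + δ ∈ U n := by
    rw [mem_U] at hz ⊢
    push_cast [Complex.add_re, Complex.ofReal_re] at hz ⊢
    linarith
  have mono : Monotone U := fun m n hmn z hz => by
    rw [mem_U] at hz ⊢
    exact hz.trans_le (by gcongr)
  have meromorphic (n : ℕ) : MeromorphicOn (Φ n) (U n) := by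
    induction n with
    | zero => simpa [Φ, U] using hf
    | succ n ih =>
      intro z hz
      have := (ih _ (shift hz)).comp_analyticAt (g := fun z : ℂ => z + δ) (by fun_prop)
      simpa only [funext (Φ_succ n)] using! ((hR z).mul this).add (hS z)
  have step (n : ℕ) : EqOn (Φ (n + 1)) (Φ n) (U n) := by
    induction n with
    | zero => exact fun z hz => (h z (by simpa [U] using hz)).symm
    | succ n ih => exact fun z hz => by rw [Φ_succ (n + 1), ih (shift hz), Φ_succ n]
  have cover (z : ℂ) : ∃ n, z ∈ U n := by
    obtain ⟨n, hn⟩ := exists_nat_gt ((c - z.re) / δ)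
    exact ⟨n, mem_U.2 (by rw [div_lt_iff₀ hδ] at hn; linarith)⟩
  obtain ⟨g, hg, hgΦ⟩ := exists_meromorphic_eqOn_of_cover (fun n => isOpen_re_gt _) mono cover
    meromorphic step
  exact ⟨g, hg, by simpa [Φ, U] using hgΦ 0⟩

theorem exists_meromorphic_extension_of_recurrence {f : ℤ → ℂ → ℂ} {R S : ℂ → ℂ} {c : ℤ → ℝ}
    {δ β : ℝ} (hδ : 0 < δ) (hR : Meromorphic R) (hS : Meromorphic S)
    (hneg : ∀ j < 0, f j = 0) (hf : ∀ j, MeromorphicOn (f j) {z | c j < z.re})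
    (hc : ∀ j, c (j - 2) ≤ c j + β)
    (h : ∀ j, 0 ≤ j → ∀ z : ℂ, c j < z.re →
      f j z = R z * f j (z + δ) + S z * f (j - 2) (z + β)) (j : ℤ) :
    ∃ g : ℂ → ℂ, Meromorphic g ∧ EqOn g (f j) {z | c j < z.re} := by
  suffices ∀ n : ℕ, ∀ j < (n : ℤ), ∃ g : ℂ → ℂ, Meromorphic g ∧ EqOn g (f j) {z | c j < z.re} from
    this (j.toNat + 1) j (by lia)
  intro n
  induction n with
  | zero => exact fun j hj => ⟨0, Meromorphic.const 0, by rw [hneg j hj]; exact eqOn_refl _ _⟩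
  | succ n ih =>
    intro j hj
    rcases lt_or_ge j 0 with hj0 | hj0
    · exact ⟨0, Meromorphic.const 0, by rw [hneg j hj0]; exact eqOn_refl _ _⟩
    obtain ⟨g, hg, hgf⟩ := ih (j - 2) (by lia)
    refine exists_meromorphic_extension_of_difference_eq hδ hR
      (hS.mul (meromorphic_comp_differentiable hg (differentiable_id.add_const (β : ℂ)))) (hf j)
      fun z hz => ?_
    have hz' : c (j - 2) < (z + β).re := (hc j).trans_lt (by simpa using hz)
    simp only [h j hj0 z hz, Pi.mul_apply, id, hgf hz']

end Meromorphic

section ParameterIntegral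

theorem mul_abs_mul_exp_le {a b η : ℝ} (h : |a - b| ≤ η) (x : ℝ) :
    η * |x| * Real.exp (a * x) ≤ Real.exp ((b + 2 * η) * x) + Real.exp ((b - 2 * η) * x) := by
  have hη : 0 ≤ η := (abs_nonneg _).trans h
  have hax : a * x ≤ b * x + η * |x| := by
    have : (a - b) * x ≤ η * |x| :=
      (le_abs_self _).trans ((abs_mul _ _).trans_le (by gcongr))
    linarith
  calc η * |x| * Real.exp (a * x)
      ≤ Real.exp (η * |x|) * Real.exp (b * x + η * |x|) := by
        gcongr
        linarith [Real.add_one_le_exp (η * |x|)]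
    _ = Real.exp (b * x) * Real.exp |2 * η * x| := by
        rw [abs_mul, abs_of_nonneg (mul_nonneg two_pos.le hη), ← Real.exp_add, ← Real.exp_add]
        ring_nf
    _ ≤ Real.exp (b * x) * (Real.exp (2 * η * x) + Real.exp (-(2 * η * x))) := by
        gcongr
        exact Real.exp_abs_le _
    _ = _ := by
        rw [mul_add, ← Real.exp_add, ← Real.exp_add]
        ring_nf

variable {Ω E : Type*} [MeasurableSpace Ω] {μ : Measure Ω} [NormedAddCommGroup E] [NormedSpace ℂ E]

theorem norm_exp_mul_ofReal_smul (w : ℂ) (x : ℝ) (v : E) :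
    ‖Complex.exp (w * x) • v‖ = Real.exp (w.re * x) * ‖v‖ := by
  rw [norm_smul, Complex.norm_exp, Complex.re_mul_ofReal]

theorem differentiableOn_integral_exp_smul {ℓ : Ω → ℝ} {φ : Ω → E} {U : Set ℝ} (hU : IsOpen U)
    (hℓ : AEStronglyMeasurable ℓ μ)
    (hint : ∀ w : ℂ, w.re ∈ U → Integrable (fun t => Complex.exp (w * ℓ t) • φ t) μ) :
    DifferentiableOn ℂ (fun w : ℂ => ∫ t, Complex.exp (w * ℓ t) • φ t ∂μ) {w | w.re ∈ U} := by
  intro w (hw : w.re ∈ U)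
  obtain ⟨ε, hε, hball⟩ := Metric.isOpen_iff.1 hU w.re hw
  obtain ⟨η, hη, hηε⟩ : ∃ η : ℝ, 0 < η ∧ 2 * η < ε := ⟨ε / 4, by positivity, by linarith⟩
  have near_re {v : ℂ} (hv : v ∈ Metric.ball w η) : |v.re - w.re| < η :=
    (Complex.abs_re_le_norm (v - w)).trans_lt (by rwa [← dist_eq_norm])
  have shift_mem {x : ℝ} (hx : |x| < ε) : (w + x).re ∈ U :=
    hball (by simpa [Real.dist_eq] using hx)
  let bound (t : Ω) : ℝ :=
    η⁻¹ * (‖Complex.exp ((w + (2 * η : ℝ)) * ℓ t) • φ t‖ +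
      ‖Complex.exp ((w + (-(2 * η) : ℝ)) * ℓ t) • φ t‖)
  have hbound : Integrable bound μ := by
    refine ((hint _ (shift_mem ?_)).norm.add (hint _ (shift_mem ?_)).norm).const_mul _ <;>
      simpa [abs_of_pos hη] using hηε
  have deriv_le (t : Ω) {v : ℂ} (hv : v ∈ Metric.ball w η) :
      ‖(ℓ t : ℂ) • Complex.exp (v * ℓ t) • φ t‖ ≤ bound t := by
    have := mul_abs_mul_exp_le (near_re hv).le (ℓ t)
    simp only [bound, norm_smul (ℓ t : ℂ), norm_exp_mul_ofReal_smul, Complex.norm_real,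
      Real.norm_eq_abs, Complex.add_re, Complex.ofReal_re, ← sub_eq_add_neg]
    rw [← add_mul, ← mul_assoc, ← mul_assoc]
    refine mul_le_mul_of_nonneg_right ?_ (norm_nonneg _)
    rwa [inv_mul_eq_div, le_div_iff₀' hη, ← mul_assoc]
  have hderiv (t : Ω) (v : ℂ) :
      HasDerivAt (fun v : ℂ => Complex.exp (v * ℓ t) • φ t)
        ((ℓ t : ℂ) • Complex.exp (v * ℓ t) • φ t) v := by
    have := ((hasDerivAt_mul_const (ℓ t : ℂ)).cexp (x := v)).smul_const (φ t)
    rwa [mul_comm, ← smul_smul] at this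
  refine (hasDerivAt_integral_of_dominated_loc_of_deriv_le (Metric.ball_mem_nhds w hη) ?_
    (hint w hw) ?_ (.of_forall fun t v => deriv_le t) hbound
    (.of_forall fun t v _ => hderiv t v)).2.differentiableAt.differentiableWithinAt
  · filter_upwards [Metric.ball_mem_nhds w hη] with v hv
    exact (hint v (hball ((near_re hv).trans (by linarith)))).aestronglyMeasurable
  · exact (Complex.continuous_ofReal.comp_aestronglyMeasurable hℓ).smul
      (hint w hw).aestronglyMeasurable

end ParameterIntegral

section DividedPower

/-- The divided power `z ^ j / j!`, extended by zero to negative `j`, so that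
`divPow · (j - 1)` is the derivative of `divPow · j` for every integer `j`. -/
def divPow (z : ℂ) (j : ℤ) : ℂ := if j < 0 then 0 else z ^ j.toNat / (j.toNat.factorial : ℂ)

theorem divPow_of_neg (z : ℂ) {j : ℤ} (hj : j < 0) : divPow z j = 0 := if_pos hj

theorem divPow_natCast (z : ℂ) (j : ℕ) : divPow z j = z ^ j / (j.factorial : ℂ) :=
  if_neg (by lia)

theorem continuous_divPow (j : ℤ) : Continuous fun z => divPow z j := by
  unfold divPow
  split_ifs <;> fun_prop

theorem hasDerivAt_divPow (z : ℂ) (j : ℤ) : HasDerivAt (divPow · j) (divPow z (j - 1)) z := by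
  rcases lt_or_ge j 0 with hj | hj
  · simpa only [divPow_of_neg _ hj, divPow_of_neg z (show j - 1 < 0 by lia)] using
      hasDerivAt_const z (0 : ℂ)
  lift j to ℕ using hj
  simp only [divPow_natCast]
  refine ((hasDerivAt_pow j z).div_const _).congr_deriv ?_
  cases j with
  | zero => simp [divPow_of_neg]
  | succ j =>
    have : ((j + 1 : ℕ) : ℤ) - 1 = j := by simp
    rw [this, divPow_natCast, Nat.factorial_succ, Nat.cast_mul, Nat.add_sub_cancel,
      mul_div_mul_left _ _ (Nat.cast_ne_zero.2 j.succ_ne_zero)]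

theorem norm_divPow_le_rpow {z : ℂ} {C r γ : ℝ} (hr : 0 < r) (h : ‖z‖ ≤ C * r ^ γ) (j : ℤ) :
    ‖divPow z j‖ ≤ C ^ j.toNat * r ^ (γ * j) := by
  have hC : 0 ≤ C := nonneg_of_mul_nonneg_left ((norm_nonneg z).trans h) (by positivity)
  rcases lt_or_ge j 0 with hj | hj
  · rw [divPow_of_neg z hj, norm_zero]
    positivity
  lift j to ℕ using hj
  rw [divPow_natCast, norm_div, norm_pow, Int.toNat_natCast, Int.cast_natCast,
    Real.rpow_mul_natCast hr.le, ← mul_pow]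
  calc ‖z‖ ^ j / ‖(j.factorial : ℂ)‖ ≤ ‖z‖ ^ j := by
        refine div_le_self (by positivity) ?_
        rw [Complex.norm_natCast]
        exact_mod_cast Nat.one_le_iff_ne_zero.2 j.factorial_ne_zero
    _ ≤ (C * r ^ γ) ^ j := by gcongr

end DividedPower

section Branch

theorem norm_cpow_of_pos {z : ℂ} (hz : 0 < z) (w : ℂ) : ‖z ^ w‖ = ‖z‖ ^ w.re := by
  obtain ⟨r, hr, rfl⟩ := RCLike.pos_iff_exists_ofReal.1 hz
  simpa [abs_of_pos hr] using Complex.norm_cpow_eq_rpow_re_of_pos hr w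

theorem log_eq_ofReal_of_pos {z : ℂ} (hz : 0 < z) : Complex.log z = (Real.log ‖z‖ : ℝ) := by
  rw [Complex.log, Complex.arg_eq_zero_iff_zero_le.2 hz.le, Complex.ofReal_zero, zero_mul, add_zero]

theorem mem_slitPlane_of_pos {z : ℂ} (hz : 0 < z) : z ∈ Complex.slitPlane :=
  .inl (Complex.pos_iff.1 hz).1

theorem logCos_eq_log {x : ℂ} (h : ∀ t ∈ Icc (0 : ℝ) 1, Complex.cos (t * x) ∈ Complex.slitPlane) :
    logCos x = Complex.log (Complex.cos x) := by
  have hderiv : ∀ t ∈ Icc (0 : ℝ) 1, HasDerivAt (fun t : ℝ => Complex.log (Complex.cos (t * x)))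
      (-(x * Complex.tan (t * x))) t := fun t ht => by
    have := ((hasDerivAt_mul_const x).ccos (x := (t : ℂ))).comp_ofReal.clog_real (h t ht)
    exact this.congr_deriv (by rw [Complex.tan]; ring)
  have hcont : ContinuousOn (fun t : ℝ => -(x * Complex.tan (t * x))) (Icc 0 1) := by
    simp only [Complex.tan]
    exact (continuousOn_const.mul (ContinuousOn.div (by fun_prop) (by fun_prop)
      fun t ht => Complex.slitPlane_ne_zero (h t ht))).neg
  rw [← uIcc_of_le zero_le_one] at hderiv hcont
  rw [logCos, ← intervalIntegral.integral_neg,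
    intervalIntegral.integral_eq_sub_of_hasDerivAt hderiv hcont.intervalIntegrable]
  simp

theorem cosPow_eq_cpow {x : ℂ} (h : ∀ t ∈ Icc (0 : ℝ) 1, Complex.cos (t * x) ∈ Complex.slitPlane)
    (s : ℂ) : cosPow s x = Complex.cos x ^ s := by
  have hx : Complex.cos x ≠ 0 := by
    simpa using Complex.slitPlane_ne_zero (h 1 (right_mem_Icc.2 zero_le_one))
  rw [cosPow, if_neg hx, logCos_eq_log h, Complex.cpow_def_of_ne_zero hx, mul_comm]

end Branch

section Ray

/-- The segment or line `{ω t | t ∈ S}` through the origin is a contour on which the cosine takes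
positive real values. The integral defining `B` runs over such a contour with `ω = 1`, the one
defining `A` over such a contour with `ω = i`. -/
structure IsPositiveRay (ω : ℂ) (S : Set ℝ) : Prop where
  isOpen : IsOpen S
  starConvex : StarConvex ℝ 0 S
  cos_pos : ∀ t ∈ S, 0 < Complex.cos (ω * t)

theorem isPositiveRay_one : IsPositiveRay 1 (Ioo (-(Real.pi / 2)) (Real.pi / 2)) where
  isOpen := isOpen_Ioo
  starConvex := (convex_Ioo _ _).starConvex ⟨by linarith [Real.pi_pos], by linarith [Real.pi_pos]⟩
  cos_pos t ht := by
    rw [one_mul, ← Complex.ofReal_cos]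
    exact_mod_cast Real.cos_pos_of_mem_Ioo ht

theorem cos_I_mul_ofReal (t : ℝ) : Complex.cos (Complex.I * t) = Real.cosh t := by
  rw [mul_comm, Complex.cos_mul_I, Complex.ofReal_cosh]

theorem isPositiveRay_I : IsPositiveRay Complex.I univ where
  isOpen := isOpen_univ
  starConvex := starConvex_univ 0
  cos_pos t _ := by
    rw [cos_I_mul_ofReal]
    exact_mod_cast Real.cosh_pos t

namespace IsPositiveRay

variable {ω : ℂ} {S : Set ℝ} {t : ℝ} (h : IsPositiveRay ω S)

include h

theorem mul_mem (ht : t ∈ S) {u : ℝ} (hu : u ∈ Icc (0 : ℝ) 1) : u * t ∈ S :=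
  h.starConvex.smul_mem ht hu.1 hu.2

theorem uIcc_subset (ht : t ∈ S) : uIcc 0 t ⊆ S :=
  segment_eq_uIcc (0 : ℝ) t ▸ starConvex_iff_segment_subset.1 h.starConvex ht

theorem cos_ne_zero (ht : t ∈ S) : Complex.cos (ω * t) ≠ 0 := (h.cos_pos t ht).ne'

theorem norm_cos_pos (ht : t ∈ S) : 0 < ‖Complex.cos (ω * t)‖ := norm_pos_iff.2 (h.cos_ne_zero ht)

theorem cos_mem_slitPlane (ht : t ∈ S) : Complex.cos (ω * t) ∈ Complex.slitPlane :=
  mem_slitPlane_of_pos (h.cos_pos t ht)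

theorem continuousOn_cos_cpow (w : ℂ) : ContinuousOn (fun t : ℝ => Complex.cos (ω * t) ^ w) S :=
  ContinuousOn.cpow_const (by fun_prop) fun _ ht => h.cos_mem_slitPlane ht

theorem cosPow_eq (s : ℂ) (ht : t ∈ S) : cosPow s (ω * t) = Complex.cos (ω * t) ^ s := by
  refine cosPow_eq_cpow (fun u hu => ?_) s
  rw [mul_left_comm, ← Complex.ofReal_mul]
  exact h.cos_mem_slitPlane (h.mul_mem ht hu)

theorem F_eq (α : ℝ) (ht : t ∈ S) :
    F α (ω * t) = F α 0 + ∫ u in (0 : ℝ)..1, ω * t * Complex.cos (ω * (u * t : ℝ)) ^ (α : ℂ) := by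
  have hF₀ : F α 0 = ∫ y in (-(Real.pi / 2))..(0 : ℝ), cosPow α (y : ℂ) := by simp [F]
  rw [F, hF₀]
  congr 1
  refine intervalIntegral.integral_congr fun u hu => ?_
  rw [uIcc_of_le zero_le_one] at hu
  simp only [mul_left_comm (u : ℂ), ← Complex.ofReal_mul, h.cosPow_eq α (h.mul_mem ht hu)]

theorem hasDerivAt_F (α : ℝ) (ht : t ∈ S) :
    HasDerivAt (fun t : ℝ => F α (ω * t)) (ω * Complex.cos (ω * t) ^ (α : ℂ)) t := by
  let f (v : ℝ) : ℂ := ω * Complex.cos (ω * v) ^ (α : ℂ)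
  have hf : ContinuousOn f S := continuousOn_const.mul (h.continuousOn_cos_cpow α)
  have F_eq_integral : ∀ t ∈ S, F α (ω * t) = F α 0 + ∫ v in (0 : ℝ)..t, f v := fun t ht => by
    have := intervalIntegral.smul_integral_comp_mul_right (a := 0) (b := 1) f t
    rw [zero_mul, one_mul] at this
    rw [h.F_eq α ht, ← this, Complex.real_smul, ← intervalIntegral.integral_const_mul]
    simp only [f, mul_left_comm (t : ℂ), mul_assoc]
  have hS : S ∈ 𝓝 t := h.isOpen.mem_nhds ht
  exact ((intervalIntegral.integral_hasDerivAt_right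
    (hf.mono (h.uIcc_subset ht)).intervalIntegrable
    (hf.stronglyMeasurableAtFilter h.isOpen t ht) (hf.continuousAt hS)).const_add
      (F α 0)).congr_of_eventuallyEq (eventually_of_mem hS F_eq_integral)

end IsPositiveRay

/-- The integrand of `A` and `B` along a ray: `(cos x) ^ w F(x) ^ j / j!` at `x = ω t`. -/
def rayIntegrand (α : ℝ) (ω w : ℂ) (j : ℤ) (t : ℝ) : ℂ :=
  Complex.cos (ω * t) ^ w * divPow (F α (ω * t)) j

/-- The contour integral `∫ (cos x) ^ w F(x) ^ j / j! dx` along the ray `{ω t | t ∈ S}`. -/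
def rayIntegral (α : ℝ) (ω : ℂ) (S : Set ℝ) (w : ℂ) (j : ℤ) : ℂ :=
  ω * ∫ t in S, rayIntegrand α ω w j t

theorem rayIntegral_of_neg (α : ℝ) (ω : ℂ) (S : Set ℝ) (w : ℂ) {j : ℤ} (hj : j < 0) :
    rayIntegral α ω S w j = 0 := by
  simp [rayIntegral, rayIntegrand, divPow_of_neg _ hj]

/-- The function `(w + α + 1) c ^ w s f ^ [j] + c ^ (w + α + 1) f ^ [j - 1]` with `c = cos (ω t)`,
`s = sin (ω t)`, `f = F (ω t)`, whose derivative is a combination of integrands `rayIntegrand`. -/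
def rayPrimitive (α : ℝ) (ω w : ℂ) (j : ℤ) (t : ℝ) : ℂ :=
  (w + α + 1) * Complex.sin (ω * t) * rayIntegrand α ω w j t +
    rayIntegrand α ω (w + α + 1) (j - 1) t

namespace IsPositiveRay

variable {α : ℝ} {ω w : ℂ} {S : Set ℝ} {t : ℝ} {j : ℤ} (h : IsPositiveRay ω S)

include h

theorem continuousOn_rayIntegrand (α : ℝ) (w : ℂ) (j : ℤ) :
    ContinuousOn (rayIntegrand α ω w j) S :=
  (h.continuousOn_cos_cpow w).mul <| (continuous_divPow j).comp_continuousOn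
    fun _ ht => (h.hasDerivAt_F α ht).continuousAt.continuousWithinAt

theorem hasDerivAt_rayIntegrand (α : ℝ) (w : ℂ) (j : ℤ) (ht : t ∈ S) :
    HasDerivAt (rayIntegrand α ω w j)
      (ω * (rayIntegrand α ω (w + α) (j - 1) t -
        w * Complex.sin (ω * t) * rayIntegrand α ω (w - 1) j t)) t := by
  have hcos : HasDerivAt (fun t : ℝ => Complex.cos (ω * t) ^ w)
      (w * Complex.cos (ω * t) ^ (w - 1) * (-Complex.sin (ω * t) * ω)) t :=
    (((hasDerivAt_const_mul ω).ccos (x := (t : ℂ))).cpow_const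
      (h.cos_mem_slitPlane ht)).comp_ofReal
  refine (hcos.mul ((hasDerivAt_divPow _ j).comp t (h.hasDerivAt_F α ht))).congr_deriv ?_
  simp only [rayIntegrand, Function.comp_apply, Complex.cpow_add _ _ (h.cos_ne_zero ht)]
  ring

theorem hasDerivAt_rayPrimitive (α : ℝ) (w : ℂ) (j : ℤ) (ht : t ∈ S) :
    HasDerivAt (rayPrimitive α ω w j)
      (ω * ((w + α + 1) * ((1 + w) * rayIntegrand α ω (w + 1) j t -
        w * rayIntegrand α ω (w - 1) j t) + rayIntegrand α ω (w + 2 * α + 1) (j - 2) t)) t := by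
  have hsin : HasDerivAt (fun t : ℝ => Complex.sin (ω * t)) (Complex.cos (ω * t) * ω) t :=
    ((hasDerivAt_const_mul ω).csin (x := (t : ℂ))).comp_ofReal
  refine (((hsin.const_mul (w + α + 1)).mul (h.hasDerivAt_rayIntegrand α w j ht)).add
    (h.hasDerivAt_rayIntegrand α (w + α + 1) (j - 1) ht)).congr_deriv ?_
  have cpow_add_one (v : ℂ) : Complex.cos (ω * t) ^ (v + 1) =
      Complex.cos (ω * t) ^ v * Complex.cos (ω * t) := by
    rw [Complex.cpow_add _ _ (h.cos_ne_zero ht), Complex.cpow_one]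
  have cpow_w : Complex.cos (ω * t) ^ w = Complex.cos (ω * t) ^ (w - 1) * Complex.cos (ω * t) := by
    rw [← cpow_add_one, sub_add_cancel]
  have cpow_add (v : ℂ) := Complex.cpow_add v α (h.cos_ne_zero ht)
  rw [show j - 1 - 1 = j - 2 by ring, show w + α + 1 - 1 = w + α by ring,
    show w + α + 1 + α = w + α + α + 1 by ring, show w + 2 * α + 1 = w + α + α + 1 by ring]
  simp only [rayIntegrand, cpow_add_one, cpow_add, cpow_w]
  linear_combination (-(w + α + 1) * w * ω * Complex.cos (ω * t) ^ (w - 1) *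
    divPow (F α (ω * t)) j) * Complex.sin_sq_add_cos_sq (ω * t)

theorem norm_rayIntegrand_le {C γ : ℝ} (hF : ‖F α (ω * t)‖ ≤ C * ‖Complex.cos (ω * t)‖ ^ γ)
    (w : ℂ) (j : ℤ) (ht : t ∈ S) :
    ‖rayIntegrand α ω w j t‖ ≤ C ^ j.toNat * ‖Complex.cos (ω * t)‖ ^ (w.re + γ * j) := by
  rw [rayIntegrand, norm_mul, norm_cpow_of_pos (h.cos_pos t ht), Real.rpow_add (h.norm_cos_pos ht),
    mul_left_comm]
  gcongr
  exact norm_divPow_le_rpow (h.norm_cos_pos ht) hF j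

theorem integrableOn_rayIntegrand {C γ : ℝ}
    (hF : ∀ t ∈ S, ‖F α (ω * t)‖ ≤ C * ‖Complex.cos (ω * t)‖ ^ γ)
    (hint : IntegrableOn (fun t : ℝ => ‖Complex.cos (ω * t)‖ ^ (w.re + γ * j)) S) :
    IntegrableOn (rayIntegrand α ω w j) S :=
  (hint.const_mul (C ^ j.toNat)).mono'
    ((h.continuousOn_rayIntegrand α w j).aestronglyMeasurable h.isOpen.measurableSet)
    ((ae_restrict_mem h.isOpen.measurableSet).mono fun t ht =>
      h.norm_rayIntegrand_le (hF t ht) w j ht)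

theorem rayIntegrand_eq_exp_smul (α : ℝ) (w : ℂ) (j : ℤ) (ht : t ∈ S) :
    rayIntegrand α ω w j t =
      Complex.exp (w * (Real.log ‖Complex.cos (ω * t)‖ : ℝ)) • divPow (F α (ω * t)) j := by
  rw [rayIntegrand, Complex.cpow_def_of_ne_zero (h.cos_ne_zero ht),
    log_eq_ofReal_of_pos (h.cos_pos t ht), mul_comm w, smul_eq_mul]

theorem differentiableOn_rayIntegral {U : Set ℝ} (hU : IsOpen U)
    (hint : ∀ w : ℂ, w.re ∈ U → IntegrableOn (rayIntegrand α ω w j) S) :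
    DifferentiableOn ℂ (fun w => rayIntegral α ω S w j) {w | w.re ∈ U} := by
  have hS := h.isOpen.measurableSet
  have hexp (w : ℂ) := fun t (ht : t ∈ S) => h.rayIntegrand_eq_exp_smul α w j ht
  have hlog : ContinuousOn (fun t : ℝ => Real.log ‖Complex.cos (ω * t)‖) S :=
    ContinuousOn.log (by fun_prop) fun t ht => (h.norm_cos_pos ht).ne'
  exact ((differentiableOn_integral_exp_smul hU (hlog.aestronglyMeasurable hS) fun w hw =>
    (integrableOn_congr_fun (hexp w) hS).1 (hint w hw)).congr
      fun w _ => setIntegral_congr_fun hS (hexp w)).const_mul ω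

/-- `hzero` says that the boundary terms of the integration by parts vanish. -/
theorem rayIntegral_recurrence (h₁ : IntegrableOn (rayIntegrand α ω (w + 1) j) S)
    (h₂ : IntegrableOn (rayIntegrand α ω (w - 1) j) S)
    (h₃ : IntegrableOn (rayIntegrand α ω (w + 2 * α + 1) (j - 2)) S)
    (hzero : ∀ g : ℝ → ℂ, (∀ t ∈ S, HasDerivAt (rayPrimitive α ω w j) (g t) t) →
      IntegrableOn g S → ∫ t in S, g t = 0) :
    (w + α + 1) * ((1 + w) * rayIntegral α ω S (w + 1) j - w * rayIntegral α ω S (w - 1) j) +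
      rayIntegral α ω S (w + 2 * α + 1) (j - 2) = 0 := by
  have h₁₂ : IntegrableOn (fun t => (w + α + 1) *
      ((1 + w) * rayIntegrand α ω (w + 1) j t - w * rayIntegrand α ω (w - 1) j t)) S :=
    ((h₁.const_mul (1 + w)).sub (h₂.const_mul w)).const_mul (w + α + 1)
  have integral_eq_zero := hzero _ (fun t ht => h.hasDerivAt_rayPrimitive α w j ht)
    ((h₁₂.add h₃).const_mul ω)
  rw [integral_const_mul, integral_add h₁₂ h₃, integral_const_mul,
    integral_sub (h₁.const_mul _) (h₂.const_mul _), integral_const_mul,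
    integral_const_mul] at integral_eq_zero
  simp only [rayIntegral]
  linear_combination integral_eq_zero

end IsPositiveRay
end Ray

namespace IsPositiveRay

theorem tendsto_rayPrimitive_zero {α C γ ε : ℝ} {ω w : ℂ} {S : Set ℝ} {j : ℤ} {l : Filter ℝ}
    (h : IsPositiveRay ω S) (hl : S ∈ l)
    (hF : ∀ t ∈ S, ‖F α (ω * t)‖ ≤ C * ‖Complex.cos (ω * t)‖ ^ γ)
    (hsin : ∀ t ∈ S, ‖Complex.sin (ω * t)‖ ≤ ‖Complex.cos (ω * t)‖ ^ ε)
    (h₁ : Tendsto (fun t : ℝ => ‖Complex.cos (ω * t)‖ ^ (ε + (w.re + γ * j))) l (𝓝 0))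
    (h₂ : Tendsto (fun t : ℝ => ‖Complex.cos (ω * t)‖ ^ ((w + α + 1).re + γ * (j - 1 : ℤ))) l
      (𝓝 0)) :
    Tendsto (rayPrimitive α ω w j) l (𝓝 0) := by
  have tendsto_sin_mul : Tendsto (fun t : ℝ => Complex.sin (ω * t) * rayIntegrand α ω w j t) l
      (𝓝 0) := by
    refine squeeze_zero_norm' (eventually_of_mem hl fun t ht => ?_)
      (by simpa using h₁.const_mul (C ^ j.toNat))
    rw [norm_mul, Real.rpow_add (h.norm_cos_pos ht), mul_left_comm]
    gcongr
    exacts [hsin t ht, h.norm_rayIntegrand_le (hF t ht) w j ht]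
  have tendsto_rayIntegrand : Tendsto (rayIntegrand α ω (w + α + 1) (j - 1)) l (𝓝 0) :=
    squeeze_zero_norm' (eventually_of_mem hl fun t ht => h.norm_rayIntegrand_le (hF t ht) _ _ ht)
      (by simpa using h₂.const_mul (C ^ (j - 1).toNat))
  unfold rayPrimitive
  simpa [← mul_assoc] using
    (tendsto_sin_mul.const_mul (w + α + 1)).add tendsto_rayIntegrand

end IsPositiveRay

section Cos

theorem norm_cos_one_mul {t : ℝ} (ht : t ∈ Ioo (-(Real.pi / 2)) (Real.pi / 2)) :
    ‖Complex.cos (1 * t)‖ = Real.cos t := by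
  rw [one_mul, ← Complex.ofReal_cos, Complex.norm_of_nonneg (Real.cos_pos_of_mem_Ioo ht).le]

theorem intervalIntegrable_cos_rpow {σ : ℝ} (hσ : -1 < σ) :
    IntervalIntegrable (fun t => Real.cos t ^ σ) volume (-(Real.pi / 2)) (Real.pi / 2) := by
  have hpi := Real.pi_pos
  suffices h : IntervalIntegrable (fun t => Real.cos t ^ σ) volume 0 (Real.pi / 2) by
    refine IntervalIntegrable.trans ?_ h
    simpa using ((IntervalIntegrable.iff_comp_neg (by finiteness)).1 h).symm
  rcases le_or_gt 0 σ with hσ₀ | hσ₀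
  · exact (Real.continuous_cos.rpow_const fun _ => Or.inr hσ₀).intervalIntegrable _ _
  have hpow : IntervalIntegrable (fun t => (2 / Real.pi * (Real.pi / 2 - t)) ^ σ) volume
      0 (Real.pi / 2) := by
    have := (intervalIntegral.intervalIntegrable_rpow' hσ (a := 0) (b := 1)).comp_mul_left
      (c := 2 / Real.pi)
    simpa using (this.comp_sub_left (Real.pi / 2)).symm
  refine hpow.mono_fun (Measurable.aestronglyMeasurable (by fun_prop)) ?_
  filter_upwards [ae_restrict_mem measurableSet_uIoc,
    ae_restrict_of_ae (volume.ae_ne (Real.pi / 2))] with t ht ht_ne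
  rw [uIoc_of_le (by positivity)] at ht
  have ht_lt : 0 < Real.pi / 2 - t := sub_pos.2 (lt_of_le_of_ne ht.2 ht_ne)
  have cos_ge : 2 / Real.pi * (Real.pi / 2 - t) ≤ Real.cos t := by
    rw [mul_sub, div_mul_div_cancel₀ hpi.ne', div_self two_ne_zero]
    exact Real.one_sub_mul_le_cos ht.1.le ht.2
  have cos_pos : 0 < Real.cos t := lt_of_lt_of_le (by positivity) cos_ge
  rw [Real.norm_of_nonneg (by positivity), Real.norm_of_nonneg (by positivity)]
  exact Real.rpow_le_rpow_of_nonpos (by positivity) cos_ge hσ₀.le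

theorem exists_norm_F_one_mul_le {α : ℝ} (hα : 0 ≤ α) :
    ∃ C, ∀ t ∈ Ioo (-(Real.pi / 2)) (Real.pi / 2),
      ‖F α (1 * t)‖ ≤ C * ‖Complex.cos (1 * t)‖ ^ (0 : ℝ) := by
  refine ⟨‖F α 0‖ + Real.pi / 2, fun t ht => ?_⟩
  rw [Real.rpow_zero, mul_one, isPositiveRay_one.F_eq α ht]
  refine norm_add_le_of_le le_rfl
    ((intervalIntegral.norm_integral_le_of_norm_le_const fun u hu => ?_).trans_eq
      (by rw [sub_zero, abs_one, mul_one]))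
  rw [uIoc_of_le zero_le_one] at hu
  have hut := isPositiveRay_one.mul_mem ht (Ioc_subset_Icc_self hu)
  rw [norm_mul, norm_cpow_of_pos (isPositiveRay_one.cos_pos _ hut), norm_cos_one_mul hut, one_mul,
    Complex.norm_real, Complex.ofReal_re]
  exact (mul_le_of_le_one_right (norm_nonneg t) (Real.rpow_le_one
    (Real.cos_pos_of_mem_Ioo hut).le (Real.cos_le_one _) hα)).trans (abs_lt.2 ht).le

/-- The integral `∫ (cos x) ^ w F(x) ^ j / j! dx` over `(-π/2, π/2)`, which is `B` up to
elementary and Gamma factors. -/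
def cosIntegral (α : ℝ) (w : ℂ) (j : ℤ) : ℂ :=
  rayIntegral α 1 (Ioo (-(Real.pi / 2)) (Real.pi / 2)) w j

variable {α : ℝ} {w : ℂ}

theorem integrableOn_rayIntegrand_one (hα : 0 ≤ α) (hw : -1 < w.re) (j : ℤ) :
    IntegrableOn (rayIntegrand α 1 w j) (Ioo (-(Real.pi / 2)) (Real.pi / 2)) := by
  obtain ⟨C, hC⟩ := exists_norm_F_one_mul_le hα
  refine isPositiveRay_one.integrableOn_rayIntegrand hC ?_
  refine IntegrableOn.congr_fun (f := fun t => Real.cos t ^ w.re) ?_ (fun t ht => ?_)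
    measurableSet_Ioo
  · rw [← intervalIntegrable_iff_integrableOn_Ioo_of_le (by linarith [Real.pi_pos])]
    exact intervalIntegrable_cos_rpow hw
  · simp only [zero_mul, add_zero, norm_cos_one_mul ht]

theorem differentiableOn_cosIntegral (hα : 0 ≤ α) (j : ℤ) :
    DifferentiableOn ℂ (fun w => cosIntegral α w j) {w | -1 < w.re} :=
  isPositiveRay_one.differentiableOn_rayIntegral isOpen_Ioi
    fun _ hw => integrableOn_rayIntegrand_one hα hw j

theorem tendsto_norm_cos_rpow_zero {l : Filter ℝ} {a σ : ℝ} (hσ : 0 < σ) (hl : l ≤ 𝓝 a)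
    (ha : Real.cos a = 0) :
    Tendsto (fun t : ℝ => ‖Complex.cos (1 * t)‖ ^ σ) l (𝓝 0) := by
  have hcos : Continuous fun t : ℝ => ‖Complex.cos (1 * t)‖ := by fun_prop
  have := ((hcos.rpow_const fun _ => Or.inr hσ.le).tendsto a).mono_left hl
  rwa [one_mul, ← Complex.ofReal_cos, ha, Complex.ofReal_zero, norm_zero,
    Real.zero_rpow hσ.ne'] at this

theorem tendsto_rayPrimitive_one (hα : 0 ≤ α) (hw : 0 < w.re) (j : ℤ) {l : Filter ℝ} {a : ℝ}
    (hl : Ioo (-(Real.pi / 2)) (Real.pi / 2) ∈ l) (hla : l ≤ 𝓝 a) (ha : Real.cos a = 0) :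
    Tendsto (rayPrimitive α 1 w j) l (𝓝 0) := by
  obtain ⟨C, hC⟩ := exists_norm_F_one_mul_le hα
  refine isPositiveRay_one.tendsto_rayPrimitive_zero hl hC (ε := 0) (fun t _ => ?_)
    (tendsto_norm_cos_rpow_zero ?_ hla ha) (tendsto_norm_cos_rpow_zero ?_ hla ha)
  · rw [Real.rpow_zero, one_mul, ← Complex.ofReal_sin, Complex.norm_real]
    exact Real.abs_sin_le_one t
  · simpa using hw
  · simp only [Complex.add_re, Complex.ofReal_re, Complex.one_re]
    linarith

theorem cosIntegral_recurrence (hα : 0 ≤ α) (hw : 0 < w.re) (j : ℤ) :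
    (w + α + 1) * ((1 + w) * cosIntegral α (w + 1) j - w * cosIntegral α (w - 1) j) +
      cosIntegral α (w + 2 * α + 1) (j - 2) = 0 := by
  have hpi : -(Real.pi / 2) < Real.pi / 2 := by linarith [Real.pi_pos]
  refine isPositiveRay_one.rayIntegral_recurrence
    (integrableOn_rayIntegrand_one hα ?_ _) (integrableOn_rayIntegrand_one hα ?_ _)
    (integrableOn_rayIntegrand_one hα ?_ _) fun g hg hint => ?_
  · simp; linarith
  · simp; linarith
  · simp; linarith
  · rw [← integral_Ioc_eq_integral_Ioo, ← intervalIntegral.integral_of_le hpi.le,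
      intervalIntegral.integral_eq_sub_of_hasDerivAt_of_tendsto hpi hg
        ((intervalIntegrable_iff_integrableOn_Ioo_of_le hpi.le).2 hint)
        (tendsto_rayPrimitive_one hα hw j (Ioo_mem_nhdsGT hpi) nhdsWithin_le_nhds (by simp))
        (tendsto_rayPrimitive_one hα hw j (Ioo_mem_nhdsLT hpi) nhdsWithin_le_nhds (by simp)),
      sub_zero]

end Cos

section Cosh

theorem norm_cos_I_mul (t : ℝ) : ‖Complex.cos (Complex.I * t)‖ = Real.cosh t := by
  rw [cos_I_mul_ofReal, Complex.norm_of_nonneg (Real.cosh_pos t).le]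

theorem norm_sin_I_mul_le (t : ℝ) :
    ‖Complex.sin (Complex.I * t)‖ ≤ ‖Complex.cos (Complex.I * t)‖ := by
  rw [norm_cos_I_mul, mul_comm, Complex.sin_mul_I, norm_mul, Complex.norm_I, mul_one,
    ← Complex.ofReal_sinh, Complex.norm_real, Real.norm_eq_abs, Real.abs_sinh, ← Real.cosh_abs]
  exact (Real.sinh_lt_cosh _).le

theorem cosh_le_exp_abs (t : ℝ) : Real.cosh t ≤ Real.exp |t| := by
  rw [← Real.cosh_abs, Real.cosh_eq]
  linarith [Real.exp_le_exp.2 (neg_le_self (abs_nonneg t))]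

theorem exp_abs_le_two_mul_cosh (t : ℝ) : Real.exp |t| ≤ 2 * Real.cosh t := by
  rw [← Real.cosh_abs, Real.cosh_eq]
  linarith [Real.exp_pos (-|t|)]

theorem tendsto_cosh_cocompact : Tendsto Real.cosh (cocompact ℝ) atTop :=
  tendsto_atTop_mono (fun t => (div_le_iff₀' two_pos).2 (exp_abs_le_two_mul_cosh t))
    ((Real.tendsto_exp_atTop.comp (tendsto_norm_cocompact_atTop (E := ℝ))).atTop_div_const two_pos)

theorem integrable_cosh_rpow {σ : ℝ} (hσ : σ < 0) : Integrable fun t => Real.cosh t ^ σ := by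
  have hcont : Continuous fun t => Real.cosh t ^ σ :=
    Real.continuous_cosh.rpow_const fun t => Or.inl (Real.cosh_pos t).ne'
  have hO : (fun t => Real.cosh t ^ σ) =O[atTop] fun t => Real.exp (σ * t) := by
    refine Asymptotics.IsBigO.of_bound (2⁻¹ ^ σ) ?_
    filter_upwards [eventually_ge_atTop 0] with t ht
    rw [Real.norm_of_nonneg (by positivity), Real.norm_of_nonneg (by positivity), mul_comm σ,
      Real.exp_mul, ← Real.mul_rpow (by positivity) (by positivity)]
    refine Real.rpow_le_rpow_of_nonpos (by positivity) ?_ hσ.le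
    have := exp_abs_le_two_mul_cosh t
    rw [abs_of_nonneg ht] at this
    linarith
  exact hcont.locallyIntegrable.integrable_of_isBigO_atTop_of_norm_isNegInvariant
    (Eventually.of_forall fun t => by simp) hO
    ⟨Ioi 0, Ioi_mem_atTop 0, integrableOn_exp_mul_Ioi hσ 0⟩

theorem integral_mul_exp_mul (a : ℝ) :
    ∫ u in (0 : ℝ)..1, a * Real.exp (a * u) = Real.exp a - 1 := by
  rw [intervalIntegral.integral_const_mul, ← smul_eq_mul,
    intervalIntegral.smul_integral_comp_mul_left, integral_exp, mul_zero, mul_one, Real.exp_zero]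

theorem exists_norm_F_I_mul_le {α : ℝ} (hα : 0 < α) :
    ∃ C, ∀ t ∈ (univ : Set ℝ),
      ‖F α (Complex.I * t)‖ ≤ C * ‖Complex.cos (Complex.I * t)‖ ^ α := by
  refine ⟨‖F α 0‖ + 2 ^ α / α, fun t ht => ?_⟩
  have integrand_le : ∀ u ∈ Ioc (0 : ℝ) 1,
      ‖Complex.I * t * Complex.cos (Complex.I * (u * t : ℝ)) ^ (α : ℂ)‖ ≤
        α⁻¹ * (α * |t| * Real.exp (α * |t| * u)) := fun u hu => by
    rw [norm_mul, norm_cpow_of_pos (isPositiveRay_I.cos_pos _ (mem_univ _)), norm_cos_I_mul,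
      norm_mul, Complex.norm_I, one_mul, Complex.norm_real, Real.norm_eq_abs, Complex.ofReal_re,
      mul_assoc α, inv_mul_cancel_left₀ hα.ne', mul_assoc, mul_comm α, Real.exp_mul]
    gcongr
    simpa [abs_mul, abs_of_pos hu.1, mul_comm] using cosh_le_exp_abs (u * t)
  have integral_le : ‖∫ u in (0 : ℝ)..1,
      Complex.I * t * Complex.cos (Complex.I * (u * t : ℝ)) ^ (α : ℂ)‖ ≤
        2 ^ α / α * Real.cosh t ^ α :=
    calc _ ≤ ∫ u in (0 : ℝ)..1, α⁻¹ * (α * |t| * Real.exp (α * |t| * u)) :=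
          intervalIntegral.norm_integral_le_of_norm_le zero_le_one
            (Eventually.of_forall integrand_le) (Continuous.intervalIntegrable (by fun_prop) _ _)
      _ = α⁻¹ * (Real.exp (α * |t|) - 1) := by
          rw [intervalIntegral.integral_const_mul, integral_mul_exp_mul]
      _ ≤ α⁻¹ * (2 * Real.cosh t) ^ α := by
          rw [mul_comm α, Real.exp_mul]
          gcongr
          exact (sub_le_self _ zero_le_one).trans (by gcongr; exact exp_abs_le_two_mul_cosh t)
      _ = _ := by
          rw [Real.mul_rpow two_pos.le (Real.cosh_pos t).le]
          ring
  rw [isPositiveRay_I.F_eq α ht, norm_cos_I_mul, add_mul]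
  refine norm_add_le_of_le (le_mul_of_one_le_right (norm_nonneg _) ?_) integral_le
  exact Real.one_le_rpow (Real.one_le_cosh t) hα.le

/-- The integral `∫ (cos x) ^ w F(x) ^ j / j! dx` over the imaginary axis, which is `A` up to
elementary and Gamma factors. -/
def coshIntegral (α : ℝ) (w : ℂ) (j : ℤ) : ℂ :=
  rayIntegral α Complex.I univ w j

variable {α : ℝ} {w : ℂ} {j : ℤ}

theorem integrableOn_rayIntegrand_I (hα : 0 < α) (hw : w.re < -(α * j)) :
    IntegrableOn (rayIntegrand α Complex.I w j) univ := by
  obtain ⟨C, hC⟩ := exists_norm_F_I_mul_le hα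
  refine isPositiveRay_I.integrableOn_rayIntegrand hC ?_
  simp only [norm_cos_I_mul]
  exact (integrable_cosh_rpow (by linarith)).integrableOn

theorem differentiableOn_coshIntegral (hα : 0 < α) (j : ℤ) :
    DifferentiableOn ℂ (fun w => coshIntegral α w j) {w | w.re < -(α * j)} :=
  isPositiveRay_I.differentiableOn_rayIntegral isOpen_Iio
    fun _ hw => integrableOn_rayIntegrand_I hα hw

theorem tendsto_rayPrimitive_I (hα : 0 < α) (hw : w.re + 1 < -(α * j)) :
    Tendsto (rayPrimitive α Complex.I w j) (cocompact ℝ) (𝓝 0) := by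
  obtain ⟨C, hC⟩ := exists_norm_F_I_mul_le hα
  have tendsto_rpow {σ : ℝ} (hσ : σ < 0) :
      Tendsto (fun t : ℝ => ‖Complex.cos (Complex.I * t)‖ ^ σ) (cocompact ℝ) (𝓝 0) := by
    simp only [norm_cos_I_mul]
    exact neg_neg σ ▸ (tendsto_rpow_neg_atTop (neg_pos.2 hσ)).comp tendsto_cosh_cocompact
  refine isPositiveRay_I.tendsto_rayPrimitive_zero univ_mem hC (ε := 1)
    (fun t _ => by simpa using norm_sin_I_mul_le t) (tendsto_rpow ?_) (tendsto_rpow ?_)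
  · linarith
  · simp only [Complex.add_re, Complex.ofReal_re, Complex.one_re, Int.cast_sub, Int.cast_one]
    linarith

theorem coshIntegral_recurrence (hα : 0 < α) (hw : w.re + 1 < -(α * j)) :
    (w + α + 1) * ((1 + w) * coshIntegral α (w + 1) j - w * coshIntegral α (w - 1) j) +
      coshIntegral α (w + 2 * α + 1) (j - 2) = 0 := by
  refine isPositiveRay_I.rayIntegral_recurrence
    (integrableOn_rayIntegrand_I hα ?_) (integrableOn_rayIntegrand_I hα ?_)
    (integrableOn_rayIntegrand_I hα ?_) fun g hg hint => ?_
  · simpa using hw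
  · simp; linarith
  · simp; linarith
  · have tendsto_zero := tendsto_rayPrimitive_I hα hw
    rw [setIntegral_univ, integral_of_hasDerivAt_of_tendsto (fun t => hg t (mem_univ t))
      (integrableOn_univ.1 hint) (tendsto_zero.mono_left atBot_le_cocompact)
      (tendsto_zero.mono_left atTop_le_cocompact), sub_zero]

end Cosh

section Extension

variable {α : ℝ}

theorem ne_zero_of_re_pos {z : ℂ} (hz : 0 < z.re) : z ≠ 0 := fun h => hz.ne' (by simp [h])

theorem exists_meromorphic_cosIntegral (hα : 0 ≤ α) (j : ℤ) :
    ∃ g : ℂ → ℂ, Meromorphic g ∧ EqOn g (fun w => cosIntegral α w j) {w | -1 < w.re} := by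
  refine exists_meromorphic_extension_of_recurrence (f := fun j w => cosIntegral α w j)
    (R := fun z => (z + 2) / (z + 1)) (S := fun z => 1 / ((z + 1) * (z + α + 2)))
    (c := fun _ => -1) (δ := 2) (β := 2 * (α + 1)) two_pos
    (fun z => by fun_prop) (fun z => by fun_prop)
    (fun _ hj => funext fun w => rayIntegral_of_neg _ _ _ _ hj)
    (fun j => ((differentiableOn_cosIntegral hα j).analyticOnNhd (isOpen_re_gt _)).meromorphicOn)
    (fun _ => by linarith) (fun j _ z hz => ?_) j
  have recurrence := cosIntegral_recurrence hα (w := z + 1)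
    (by rw [Complex.add_re, Complex.one_re]; linarith) j
  rw [show z + 1 + 1 = z + (2 : ℝ) by push_cast; ring, add_sub_cancel_right,
    show z + 1 + 2 * α + 1 = z + (2 * (α + 1) : ℝ) by push_cast; ring] at recurrence
  have h₁ : z + 1 ≠ 0 := ne_zero_of_re_pos (by simp; linarith)
  have h₂ : z + α + 2 ≠ 0 := ne_zero_of_re_pos (by simp; linarith)
  field_simp
  linear_combination -recurrence

theorem exists_meromorphic_coshIntegral (hα : 0 < α) (j : ℤ) :
    ∃ g : ℂ → ℂ, Meromorphic g ∧
      EqOn g (fun w => coshIntegral α (-w) j) {w | α * (j + 1) < w.re} := by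
  refine exists_meromorphic_extension_of_recurrence (f := fun j w => coshIntegral α (-w) j)
    (R := fun z => (z + 1) / z) (S := fun z => 1 / (z * (α - z)))
    (c := fun j => α * (j + 1)) (δ := 2) (β := -(2 * α)) two_pos
    (fun z => by fun_prop) (fun z => by fun_prop)
    (fun j hj => funext fun w => rayIntegral_of_neg _ _ _ _ hj)
    (fun j => (DifferentiableOn.analyticOnNhd ?_ (isOpen_re_gt _)).meromorphicOn)
    (fun j => by push_cast; linarith) (fun j hj z hz => ?_) j
  · exact (differentiableOn_coshIntegral hα j).comp (differentiableOn_neg _)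
      fun w (hw : α * (j + 1) < w.re) => by
        change (-w).re < _
        rw [Complex.neg_re]
        linarith
  have hz' : α < z.re :=
    (le_mul_of_one_le_right hα.le (by exact_mod_cast Int.le_add_of_nonneg_left hj)).trans_lt hz
  have recurrence := coshIntegral_recurrence hα (w := -z - 1) (j := j)
    (by rw [Complex.sub_re, Complex.neg_re, Complex.one_re]; linarith)
  rw [sub_add_cancel, show -z - 1 - 1 = -(z + (2 : ℝ)) by push_cast; ring,
    show -z - 1 + 2 * α + 1 = -(z + (-(2 * α) : ℝ)) by push_cast; ring] at recurrence
  have h₁ : z ≠ 0 := ne_zero_of_re_pos (hα.trans hz')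
  have h₂ : α - z ≠ 0 := sub_ne_zero.2 fun h => hz'.ne (by rw [← h, Complex.ofReal_re])
  field_simp
  linear_combination -recurrence

end Extension

section Continuation

theorem IsPositiveRay.cosPow_mul_F_pow {ω : ℂ} {S : Set ℝ} {t : ℝ} (h : IsPositiveRay ω S)
    (α : ℝ) (w : ℂ) (j : ℕ) (ht : t ∈ S) :
    cosPow w (ω * t) * F α (ω * t) ^ j = j.factorial * rayIntegrand α ω w j t := by
  have := Nat.cast_ne_zero (R := ℂ).2 j.factorial_ne_zero
  rw [h.cosPow_eq w ht, rayIntegrand, divPow_natCast]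
  field_simp

theorem integralA_eq_coshIntegral (α : ℝ) (j : ℕ) (κ : ℂ) :
    integralA α j κ = (α : ℂ) ^ (j + 1) *
      (Complex.Gamma (κ + j + 1) / (2 * Real.pi * Complex.I)) *
        coshIntegral α (-(α * (κ + j))) j := by
  have := Nat.cast_ne_zero (R := ℂ).2 j.factorial_ne_zero
  rw [integralA, integral_mul_const, coshIntegral, rayIntegral, setIntegral_univ]
  simp only [isPositiveRay_I.cosPow_mul_F_pow α _ j (mem_univ _), integral_const_mul]
  field_simp

theorem integralB_eq_cosIntegral (α : ℝ) (j : ℕ) (κ : ℂ) :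
    integralB α j κ = (α : ℂ) ^ j * (Complex.Gamma κ)⁻¹ * cosIntegral α (α * κ) j := by
  have := Nat.cast_ne_zero (R := ℂ).2 j.factorial_ne_zero
  have cosPow_mul_F_pow {x : ℝ} (hx : x ∈ Ioo (-(Real.pi / 2)) (Real.pi / 2)) :
      cosPow (α * κ) x * F α x ^ j = j.factorial * rayIntegrand α 1 (α * κ) j x := by
    rw [← isPositiveRay_one.cosPow_mul_F_pow α _ j hx, one_mul]
  rw [integralB, cosIntegral, rayIntegral,
    intervalIntegral.integral_of_le (by linarith [Real.pi_pos]), integral_Ioc_eq_integral_Ioo,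
    setIntegral_congr_fun measurableSet_Ioo fun x hx => cosPow_mul_F_pow hx, integral_const_mul,
    mul_comm (Complex.Gamma κ)]
  field_simp

theorem meromorphicContinuation_re_gt_spec {f g : ℂ → ℂ} {c c' : ℝ}
    (hf : DifferentiableOn ℂ f {z | c < z.re}) (hg : Meromorphic g)
    (h : EqOn g f {z | c' < z.re}) :
    Meromorphic (meromorphicContinuation f {z | c < z.re}) ∧
      EqOn (meromorphicContinuation f {z | c < z.re}) f {z | c < z.re} :=
  meromorphicContinuation_spec (z₀ := (max c c' + 1 : ℝ)) (isOpen_re_gt c)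
    (convex_halfSpace_re_gt c).isPreconnected hf hg
    (by simp [(le_max_left c c').trans_lt (lt_add_one _)])
    (h.eventuallyEq_of_mem ((isOpen_re_gt c').mem_nhds
      (by simp [(le_max_right c c').trans_lt (lt_add_one _)])))

variable {α : ℝ}

theorem differentiableOn_integralA (hα : 0 < α) (j : ℕ) :
    DifferentiableOn ℂ (integralA α j) {z | 0 < z.re} := by
  have differentiable_Gamma :
      DifferentiableOn ℂ (fun κ : ℂ => Complex.Gamma (κ + j + 1)) {z | 0 < z.re} :=
    fun κ (hκ : 0 < κ.re) => by
      have ne_neg_natCast (m : ℕ) : κ + j + 1 ≠ -m := fun h =>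
        ne_zero_of_re_pos (z := κ + j + 1 + m)
          (by simp only [Complex.add_re, Complex.natCast_re, Complex.one_re]; positivity)
          (by rw [h, neg_add_cancel])
      exact ((Complex.differentiableAt_Gamma _ ne_neg_natCast).comp κ
        (f := fun κ : ℂ => κ + j + 1) (by fun_prop)).differentiableWithinAt
  have differentiable_coshIntegral :
      DifferentiableOn ℂ (fun κ : ℂ => coshIntegral α (-(α * (κ + j))) j) {z | 0 < z.re} :=
    (differentiableOn_coshIntegral hα j).comp (f := fun κ : ℂ => -(α * (κ + j))) (by fun_prop)
      fun κ (hκ : 0 < κ.re) => by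
        change (-(α * (κ + j)) : ℂ).re < _
        simpa [mul_add] using mul_pos hα hκ
  exact (((differentiable_Gamma.div_const _).const_mul _).mul
    differentiable_coshIntegral).congr fun κ _ => integralA_eq_coshIntegral α j κ

theorem neg_one_lt_re_mul (hα : 0 < α) {κ : ℂ} (hκ : -(1 / α) < κ.re) : -1 < (α * κ).re := by
  rwa [Complex.re_ofReal_mul, ← div_lt_iff₀' hα, neg_div]

theorem differentiableOn_integralB (hα : 0 < α) (j : ℕ) :
    DifferentiableOn ℂ (integralB α j) {z | -(1 / α) < z.re} := by
  have differentiable_cosIntegral :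
      DifferentiableOn ℂ (fun κ : ℂ => cosIntegral α (α * κ) j) {z | -(1 / α) < z.re} :=
    (differentiableOn_cosIntegral hα.le j).comp (f := fun κ : ℂ => α * κ) (by fun_prop)
      fun κ hκ => neg_one_lt_re_mul hα hκ
  exact ((Complex.differentiable_one_div_Gamma.differentiableOn.const_mul _).mul
    differentiable_cosIntegral).congr fun κ _ => integralB_eq_cosIntegral α j κ

theorem meromorphicContinuation_integralA_spec (hα : 0 < α) (j : ℕ) :
    Meromorphic (meromorphicContinuation (integralA α j) {z | 0 < z.re}) ∧
      EqOn (meromorphicContinuation (integralA α j) {z | 0 < z.re}) (integralA α j)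
        {z | 0 < z.re} := by
  obtain ⟨g, hg, hg_eq⟩ := exists_meromorphic_coshIntegral hα j
  have meromorphic_Gamma : Meromorphic fun κ : ℂ => Complex.Gamma (κ + j + 1) :=
    meromorphic_comp_differentiable Meromorphic.Gamma (by fun_prop)
  have meromorphic_g : Meromorphic fun κ : ℂ => g (α * (κ + j)) :=
    meromorphic_comp_differentiable hg (by fun_prop)
  refine meromorphicContinuation_re_gt_spec (differentiableOn_integralA hα j)
    (((Meromorphic.const ((α : ℂ) ^ (j + 1))).mul
      (meromorphic_Gamma.div (Meromorphic.const (2 * Real.pi * Complex.I)))).mul meromorphic_g)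
    (c' := 1) fun κ (hκ : 1 < κ.re) => ?_
  have h_re : α * ((j : ℤ) + 1) < (α * (κ + j)).re := by
    rw [Complex.re_ofReal_mul, Complex.add_re, Complex.natCast_re, Int.cast_natCast, add_comm]
    gcongr
  simp only [Pi.mul_apply, Pi.div_apply, integralA_eq_coshIntegral]
  rw [hg_eq h_re]

theorem meromorphicContinuation_integralB_spec (hα : 0 < α) (j : ℕ) :
    Meromorphic (meromorphicContinuation (integralB α j) {z | -(1 / α) < z.re}) ∧
      EqOn (meromorphicContinuation (integralB α j) {z | -(1 / α) < z.re}) (integralB α j)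
        {z | -(1 / α) < z.re} := by
  obtain ⟨g, hg, hg_eq⟩ := exists_meromorphic_cosIntegral hα.le j
  have meromorphic_g : Meromorphic fun κ : ℂ => g (α * κ) :=
    meromorphic_comp_differentiable hg (by fun_prop)
  refine meromorphicContinuation_re_gt_spec (differentiableOn_integralB hα j)
    (((Meromorphic.const ((α : ℂ) ^ j)).mul Meromorphic.Gamma.inv).mul meromorphic_g)
    (c' := -(1 / α)) fun κ hκ => ?_
  simp only [Pi.mul_apply, Pi.inv_apply, integralB_eq_cosIntegral]
  rw [hg_eq (neg_one_lt_re_mul hα hκ)]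

variable {ν κ : ℂ}

theorem A_eq_meromorphicContinuation (α : ℝ) {j : ℕ} (h : ν - κ = j) :
    A α ν κ = meromorphicContinuation (integralA α j) {z | 0 < z.re} κ := by
  have hex : ∃ j : ℕ, ν - κ = j := ⟨j, h⟩
  have choose_eq : hex.choose = j := by exact_mod_cast hex.choose_spec.symm.trans h
  rw [A, dif_pos hex, choose_eq]

theorem B_eq_meromorphicContinuation (α : ℝ) {j : ℕ} (h : ν - κ = j) :
    B α ν κ = meromorphicContinuation (integralB α j) {z | -(1 / α) < z.re} κ := by
  have hex : ∃ j : ℕ, ν - κ = j := ⟨j, h⟩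
  have choose_eq : hex.choose = j := by exact_mod_cast hex.choose_spec.symm.trans h
  rw [B, dif_pos hex, choose_eq]

theorem A_eq_integralA (hα : 0 < α) {j : ℕ} (h : ν - κ = j) (hκ : 0 < κ.re) :
    A α ν κ = integralA α j κ := by
  rw [A_eq_meromorphicContinuation α h]
  exact (meromorphicContinuation_integralA_spec hα j).2 hκ

theorem B_eq_integralB (hα : 0 < α) {j : ℕ} (h : ν - κ = j) (hκ : -(1 / α) < κ.re) :
    B α ν κ = integralB α j κ := by
  rw [B_eq_meromorphicContinuation α h]
  exact (meromorphicContinuation_integralB_spec hα j).2 hκ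

theorem meromorphic_A (hα : 0 < α) {ν κ : ℂ → ℂ} (hκ : Differentiable ℂ κ) {j : ℕ}
    (h : ∀ z, ν z - κ z = j) : Meromorphic fun z => A α (ν z) (κ z) := by
  simp only [A_eq_meromorphicContinuation α (h _)]
  exact meromorphic_comp_differentiable (meromorphicContinuation_integralA_spec hα j).1 hκ

theorem meromorphic_B (hα : 0 < α) {ν κ : ℂ → ℂ} (hκ : Differentiable ℂ κ) {j : ℕ}
    (h : ∀ z, ν z - κ z = j) : Meromorphic fun z => B α (ν z) (κ z) := by
  simp only [B_eq_meromorphicContinuation α (h _)]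
  exact meromorphic_comp_differentiable (meromorphicContinuation_integralB_spec hα j).1 hκ

end Continuation

section Pairing

/-- The product of integrals which, at `x = α m`, a summand on the left-hand sides of the two
identities is a multiple of. -/
def leftPairing (α : ℝ) (x : ℂ) (j i : ℤ) : ℂ :=
  (x + 1) * cosIntegral α x j * coshIntegral α (-(x + 2)) i

/-- The product of integrals which, at `x = α m`, a summand `B{n, m} A[m, k]` on the right-hand
sides of the two identities is a multiple of. -/
def rightPairing (α : ℝ) (x : ℂ) (j i : ℤ) : ℂ :=
  x * cosIntegral α x j * coshIntegral α (-x) i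

/-- The difference of a `leftPairing` and a neighbouring `rightPairing`. -/
def pairingDefect (α : ℝ) (x : ℂ) (j i : ℤ) : ℂ :=
  cosIntegral α (x + α) j * coshIntegral α (-(x - α)) i / x

variable {α : ℝ} {x : ℂ} {i : ℤ}

theorem leftPairing_eq_rightPairing_add (hα : 0 < α) (hx : α < x.re) (hxi : α * i < x.re)
    (j : ℤ) :
    leftPairing α x j i = rightPairing α x j i + pairingDefect α (x - α) j (i - 2) := by
  have recurrence := coshIntegral_recurrence hα (w := -x - 1) (j := i)
    (by simpa using hxi)
  rw [sub_add_cancel, show -x - 1 - 1 = -(x + 2) by ring,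
    show -x - 1 + 2 * α + 1 = -(x - α - α) by ring] at recurrence
  have hx' : x - α ≠ 0 := ne_zero_of_re_pos (by simpa using hx)
  rw [leftPairing, rightPairing, pairingDefect, sub_add_cancel]
  field_simp
  linear_combination -cosIntegral α x j * recurrence

theorem leftPairing_eq_rightPairing_add_two_add (hα : 0 ≤ α) (hx : -1 < x.re) (j i : ℤ) :
    leftPairing α x j i =
      rightPairing α (x + 2) j i + pairingDefect α (x + 2 + α) (j - 2) i := by
  have recurrence := cosIntegral_recurrence hα (w := x + 1) (by simp; linarith) j
  rw [show x + 1 + 1 = x + 2 by ring, add_sub_cancel_right,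
    show x + 1 + 2 * α + 1 = x + 2 + α + α by ring] at recurrence
  have hx' : x + 2 + α ≠ 0 := ne_zero_of_re_pos (by simp; linarith)
  rw [leftPairing, rightPairing, pairingDefect, add_sub_cancel_right]
  field_simp
  linear_combination -coshIntegral α (-(x + 2)) i * recurrence

theorem pairingDefect_of_left_neg (α : ℝ) (x : ℂ) {j : ℤ} (hj : j < 0) (i : ℤ) :
    pairingDefect α x j i = 0 := by
  rw [pairingDefect, cosIntegral, rayIntegral_of_neg _ _ _ _ hj, zero_mul, zero_div]

theorem pairingDefect_of_right_neg (α : ℝ) (x : ℂ) (j : ℤ) {i : ℤ} (hi : i < 0) :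
    pairingDefect α x j i = 0 := by
  rw [pairingDefect, coshIntegral, rayIntegral_of_neg _ _ _ _ hi, mul_zero, zero_div]

theorem sum_leftPairing_eq_of_down (hα : 0 < α) (N : ℤ) {K : ℕ}
    (hx : α * (K + 1) + K < x.re) :
    ∑ σ ∈ Finset.range (K / 2 + 1),
        leftPairing α (x - 2 * α * σ) (N + 2 * σ) (K - 2 * σ) =
      ∑ σ ∈ Finset.range (K / 2 + 1),
        rightPairing α (x - 2 * α * σ - 2 * σ) (N + 2 * σ) (K - 2 * σ) := by
  have re_gt (σ : ℕ) {p : ℕ} (hp : 2 * p ≤ K) :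
      α * (K - 2 * σ) + α < (x - 2 * α * σ - 2 * p).re := by
    have : 2 * (p : ℝ) ≤ K := by exact_mod_cast hp
    simp
    linarith
  have re_gt' {σ p : ℕ} (hσ : 2 * σ ≤ K) (hp : 2 * p ≤ K) :
      α < (x - 2 * α * σ - 2 * p).re := by
    have : 0 ≤ α * (K - 2 * σ) := mul_nonneg hα.le (sub_nonneg.2 (by exact_mod_cast hσ))
    linarith [re_gt σ hp]
  have ladder := sum_ladder (n := K / 2 + 1)
    (E := fun σ p => leftPairing α (x - 2 * α * σ - 2 * p) (N + 2 * σ) (K - 2 * σ))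
    (D := fun σ p => rightPairing α (x - 2 * α * σ - 2 * p) (N + 2 * σ) (K - 2 * σ))
    (G := fun σ p => pairingDefect α (x - 2 * α * σ - 2 * p + α) (N + 2 * σ - 2) (K - 2 * σ))
    (fun σ hσ p hp => ?_) (fun σ hσ p hp => ?_)
  · have boundary (p : ℕ) : pairingDefect α (x - 2 * α * (K / 2 + 1 : ℕ) - 2 * p + α)
        (N + 2 * (K / 2 + 1 : ℕ) - 2) (K - 2 * (K / 2 + 1 : ℕ)) = 0 :=
      pairingDefect_of_right_neg _ _ _ (by lia)
    simpa only [boundary, Finset.sum_const_zero, add_zero, Nat.cast_zero, mul_zero, sub_zero]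
      using ladder
  · convert leftPairing_eq_rightPairing_add hα (re_gt' (σ := σ) (p := p) (by lia) (by lia))
      (i := K - 2 * σ) ?_ _ using 3
    · push_cast; ring
    · push_cast; ring
    · push_cast; ring
    · push_cast; linarith [re_gt σ (p := p) (by lia)]
  · convert leftPairing_eq_rightPairing_add_two_add hα.le (x := x - 2 * α * σ - 2 * (p + 1 : ℕ))
      ?_ _ _ using 3
    · push_cast; ring
    · push_cast; ring
    · linarith [re_gt' (σ := σ) (p := p + 1) (by lia) (by lia)]

theorem sum_leftPairing_eq_of_up (hα : 0 < α) (N : ℕ) {K : ℕ} (hx : α * K < x.re) :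
    ∑ σ ∈ Finset.range (N / 2),
        leftPairing α (x + 2 * α * (σ + 1)) (N - 2 * (σ + 1)) (K + 2 * (σ + 1)) =
      ∑ σ ∈ Finset.range (N / 2),
        rightPairing α (x + 2 * α * (σ + 1) + 2 * (σ + 1))
          (N - 2 * (σ + 1)) (K + 2 * (σ + 1)) := by
  have re_gt (σ p : ℕ) : α * (K + 2 * (σ + 1)) < (x + 2 * α * (σ + 1) + 2 * p).re := by
    simp
    linarith [p.cast_nonneg (α := ℝ)]
  have re_gt' (σ p : ℕ) : α < (x + 2 * α * (σ + 1) + 2 * p).re :=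
    (le_mul_of_one_le_right hα.le (by norm_cast; lia)).trans_lt (re_gt σ p)
  have ladder := sum_ladder (n := N / 2)
    (E := fun σ p => leftPairing α (x + 2 * α * (σ + 1) + 2 * p)
      (N - 2 * (σ + 1)) (K + 2 * (σ + 1)))
    (D := fun σ p => rightPairing α (x + 2 * α * (σ + 1) + 2 * (p + 1))
      (N - 2 * (σ + 1)) (K + 2 * (σ + 1)))
    (G := fun σ p => pairingDefect α (x + 2 * α * σ + α + 2 * (p + 1))
      (N - 2 * (σ + 1)) (K + 2 * σ))
    (fun σ _ p _ => ?_) (fun σ _ p _ => ?_)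
  · have boundary (p : ℕ) : pairingDefect α (x + 2 * α * (N / 2 : ℕ) + α + 2 * (p + 1))
        (N - 2 * ((N / 2 : ℕ) + 1)) (K + 2 * (N / 2 : ℕ)) = 0 :=
      pairingDefect_of_left_neg _ _ (by lia) _
    simpa only [boundary, Finset.sum_const_zero, add_zero, Nat.cast_zero, mul_zero] using ladder
  · convert leftPairing_eq_rightPairing_add_two_add hα.le
      (by linarith [re_gt' σ p] : -1 < (x + 2 * α * (σ + 1) + 2 * p).re) _ _ using 3 <;>
      (push_cast; ring)
  · convert leftPairing_eq_rightPairing_add hα (re_gt' σ (p + 1)) (i := K + 2 * (σ + 1))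
      (by simpa using re_gt σ (p + 1)) _ using 3 <;>
      (push_cast; ring)

end Pairing

section Terms

/-- The summand on the left-hand sides of the two identities. -/
def leftTerm (α : ℝ) (n m κ : ℂ) : ℂ :=
  B α n m * ((m + 1 / α) * Complex.Gamma m / Complex.Gamma (m + 1 + 2 / α)) *
    A α (m + 2 / α) (κ + 2 / α)

/-- The summand `B{n, m} A[m, κ]` on the right-hand sides of the two identities. -/
def rightTerm (α : ℝ) (n m κ : ℂ) : ℂ :=
  B α n m * A α m κ

section Meromorphic

variable {α : ℝ} {n m κ : ℂ → ℂ} {j i : ℕ}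

theorem meromorphic_leftTerm (hα : 0 < α) (hm : Differentiable ℂ m) (hκ : Differentiable ℂ κ)
    (hj : ∀ z, n z - m z = j) (hi : ∀ z, m z - κ z = i) :
    Meromorphic fun z => leftTerm α (n z) (m z) (κ z) :=
  ((meromorphic_B hα hm hj).mul
    (((show Meromorphic fun z => m z + 1 / α from
        fun z => ((hm.add_const _).analyticAt z).meromorphicAt).mul
      (meromorphic_comp_differentiable Meromorphic.Gamma hm)).div
        (meromorphic_comp_differentiable Meromorphic.Gamma
          (g := fun z => m z + 1 + 2 / α) (by fun_prop)))).mul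
    (meromorphic_A hα (hκ.add_const _) fun z => by rw [add_sub_add_right_eq_sub, hi])

theorem meromorphic_rightTerm (hα : 0 < α) (hm : Differentiable ℂ m) (hκ : Differentiable ℂ κ)
    (hj : ∀ z, n z - m z = j) (hi : ∀ z, m z - κ z = i) :
    Meromorphic fun z => rightTerm α (n z) (m z) (κ z) :=
  (meromorphic_B hα hm hj).mul (meromorphic_A hα hκ hi)

end Meromorphic

variable {α : ℝ} {n m κ : ℂ} {j i : ℤ}

theorem leftTerm_eq_leftPairing (hα : 0 < α) (hκ : 0 < κ.re) (hj₀ : 0 ≤ j) (hi₀ : 0 ≤ i)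
    (hj : n - m = j) (hi : m - κ = i) :
    leftTerm α n m κ =
      α ^ (j + i) / (2 * Real.pi * Complex.I) * leftPairing α (α * m) j i := by
  lift j to ℕ using hj₀
  lift i to ℕ using hi₀
  rw [Int.cast_natCast] at hj hi
  obtain rfl : m = κ + i := by rw [← hi, add_sub_cancel]
  have two_div_re : 0 < (2 / α : ℂ).re := by
    rw [← Complex.ofReal_ofNat, ← Complex.ofReal_div, Complex.ofReal_re]; positivity
  have m_re : 0 < (κ + i).re := by rw [Complex.add_re, Complex.natCast_re]; positivity
  have α_ne : (α : ℂ) ≠ 0 := Complex.ofReal_ne_zero.2 hα.ne'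
  have Gamma_ne := Complex.Gamma_ne_zero_of_re_pos m_re
  have Gamma_ne' : Complex.Gamma (κ + i + 1 + 2 / α) ≠ 0 :=
    Complex.Gamma_ne_zero_of_re_pos
      (by rw [Complex.add_re, Complex.add_re, Complex.one_re]; positivity)
  rw [leftTerm, B_eq_integralB hα hj ((neg_lt_zero.2 (by positivity)).trans m_re),
    A_eq_integralA hα (by rw [add_sub_add_right_eq_sub, hi])
      (by rw [Complex.add_re]; positivity),
    integralB_eq_cosIntegral, integralA_eq_coshIntegral, leftPairing, add_right_comm κ (2 / α),
    add_right_comm _ (2 / (α : ℂ)) 1,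
    show (α : ℂ) * (κ + i + 2 / α) = α * (κ + i) + 2 by field_simp, ← Nat.cast_add, zpow_natCast]
  generalize Complex.Gamma (κ + i + 1 + 2 / α) = γ at Gamma_ne' ⊢
  field_simp
  ring

theorem rightTerm_eq_rightPairing (hα : 0 < α) (hκ : 0 < κ.re) (hj₀ : 0 ≤ j) (hi₀ : 0 ≤ i)
    (hj : n - m = j) (hi : m - κ = i) :
    rightTerm α n m κ =
      α ^ (j + i) / (2 * Real.pi * Complex.I) * rightPairing α (α * m) j i := by
  lift j to ℕ using hj₀
  lift i to ℕ using hi₀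
  rw [Int.cast_natCast] at hj hi
  obtain rfl : m = κ + i := by rw [← hi, add_sub_cancel]
  have m_re : 0 < (κ + i).re := by rw [Complex.add_re, Complex.natCast_re]; positivity
  have Gamma_ne := Complex.Gamma_ne_zero_of_re_pos m_re
  rw [rightTerm, B_eq_integralB hα hj ((neg_lt_zero.2 (by positivity)).trans m_re),
    A_eq_integralA hα hi hκ, integralB_eq_cosIntegral, integralA_eq_coshIntegral, rightPairing,
    Complex.Gamma_add_one _ (ne_zero_of_re_pos m_re), ← Nat.cast_add, zpow_natCast]
  field_simp
  ring

end Terms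

section Identities

variable {α : ℝ} {n d k : ℂ} {N K : ℕ}

theorem re_natCast_div_ofReal (q : ℕ) (α : ℝ) : (q / α : ℂ).re = q / α := by
  rw [← Complex.ofReal_natCast, ← Complex.ofReal_div, Complex.ofReal_re]

theorem sum_leftTerm_eq_of_down_of_re_gt (hα : 0 < α) (hn : n - d = N) (hd : d - k = K)
    (hk : 1 + K / α < k.re) :
    ∑ s ∈ (Finset.range (K + 1)).filter Even, leftTerm α n (d - s) k =
      ∑ q ∈ (Finset.range (K + 1)).filter Even,
        rightTerm α (n - q / α) (d - q - q / α) (k - q / α) := by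
  have α_ne : (α : ℂ) ≠ 0 := Complex.ofReal_ne_zero.2 hα.ne'
  have αd_re : α * (K + 1) + K < (α * d).re := by
    have := mul_lt_mul_of_pos_left hk hα
    rw [mul_add, mul_div_cancel₀ _ hα.ne'] at this
    rw [← sub_add_cancel d k, hd, Complex.re_ofReal_mul, Complex.add_re, Complex.natCast_re]
    linarith
  have re_pos {q : ℕ} (hq : q ≤ K) : 0 < (k - q / α).re := by
    have : (q / α : ℝ) ≤ K / α := by gcongr
    rw [Complex.sub_re, re_natCast_div_ofReal]
    linarith
  have left {σ : ℕ} (hσ : σ ∈ Finset.range (K / 2 + 1)) :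
      leftTerm α n (d - (2 * σ : ℕ)) k = α ^ (N + K : ℤ) / (2 * Real.pi * Complex.I) *
        leftPairing α (α * d - 2 * α * σ) (N + 2 * σ) (K - 2 * σ) := by
    have := Finset.mem_range.1 hσ
    rw [leftTerm_eq_leftPairing hα (by simpa using re_pos K.zero_le) (j := N + 2 * σ)
      (i := K - 2 * σ) (by lia) (by lia) (by push_cast; rw [← hn]; ring)
      (by push_cast; rw [← hd]; ring)]
    push_cast
    ring_nf
  have right {σ : ℕ} (hσ : σ ∈ Finset.range (K / 2 + 1)) :
      rightTerm α (n - (2 * σ : ℕ) / α) (d - (2 * σ : ℕ) - (2 * σ : ℕ) / α)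
          (k - (2 * σ : ℕ) / α) = α ^ (N + K : ℤ) / (2 * Real.pi * Complex.I) *
        rightPairing α (α * d - 2 * α * σ - 2 * σ) (N + 2 * σ) (K - 2 * σ) := by
    have := Finset.mem_range.1 hσ
    rw [rightTerm_eq_rightPairing hα (re_pos (by lia)) (j := N + 2 * σ) (i := K - 2 * σ)
      (by lia) (by lia) (by push_cast; rw [← hn]; ring) (by push_cast; rw [← hd]; ring),
      mul_sub, mul_div_cancel₀ _ α_ne]
    push_cast
    ring_nf
  rw [sum_range_filter_even, sum_range_filter_even, Finset.sum_congr rfl fun _ => left,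
    Finset.sum_congr rfl fun _ => right, ← Finset.mul_sum, ← Finset.mul_sum,
    sum_leftPairing_eq_of_down hα N αd_re]

theorem sum_leftTerm_eq_of_up_of_re_gt (hα : 0 < α) (hn : n - d = N) (hd : d - k = K)
    (hk : 0 < k.re) :
    ∑ s ∈ (Finset.Icc 1 N).filter Even, leftTerm α n (d + s) k =
      ∑ q ∈ (Finset.Icc 1 N).filter Even,
        rightTerm α (n + q / α) (d + q + q / α) (k + q / α) := by
  have α_ne : (α : ℂ) ≠ 0 := Complex.ofReal_ne_zero.2 hα.ne'
  have αd_re : α * K < (α * d).re := by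
    rw [← sub_add_cancel d k, hd, Complex.re_ofReal_mul, Complex.add_re, Complex.natCast_re]
    gcongr
    linarith
  have left {σ : ℕ} (hσ : σ ∈ Finset.range (N / 2)) :
      leftTerm α n (d + (2 * (σ + 1) : ℕ)) k = α ^ (N + K : ℤ) / (2 * Real.pi * Complex.I) *
        leftPairing α (α * d + 2 * α * (σ + 1)) (N - 2 * (σ + 1)) (K + 2 * (σ + 1)) := by
    have := Finset.mem_range.1 hσ
    rw [leftTerm_eq_leftPairing hα hk (j := N - 2 * (σ + 1)) (i := K + 2 * (σ + 1))
      (by lia) (by lia) (by push_cast; rw [← hn]; ring) (by push_cast; rw [← hd]; ring)]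
    push_cast
    ring_nf
  have right {σ : ℕ} (hσ : σ ∈ Finset.range (N / 2)) :
      rightTerm α (n + (2 * (σ + 1) : ℕ) / α) (d + (2 * (σ + 1) : ℕ) + (2 * (σ + 1) : ℕ) / α)
          (k + (2 * (σ + 1) : ℕ) / α) = α ^ (N + K : ℤ) / (2 * Real.pi * Complex.I) *
        rightPairing α (α * d + 2 * α * (σ + 1) + 2 * (σ + 1))
          (N - 2 * (σ + 1)) (K + 2 * (σ + 1)) := by
    have := Finset.mem_range.1 hσ
    rw [rightTerm_eq_rightPairing hα
      (by rw [Complex.add_re, re_natCast_div_ofReal]; positivity)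
      (j := N - 2 * (σ + 1)) (i := K + 2 * (σ + 1)) (by lia) (by lia)
      (by push_cast; rw [← hn]; ring) (by push_cast; rw [← hd]; ring), mul_add (α : ℂ),
      mul_div_cancel₀ _ α_ne]
    push_cast
    ring_nf
  rw [sum_Icc_filter_even, sum_Icc_filter_even, Finset.sum_congr rfl fun _ => left,
    Finset.sum_congr rfl fun _ => right, ← Finset.mul_sum, ← Finset.mul_sum,
    sum_leftPairing_eq_of_up hα N αd_re]

theorem eventually_sum_leftTerm_eq_of_down (hα : 0 < α) (N K : ℕ) :
    ∀ᶠ k : ℂ in codiscrete ℂ, ∀ n d : ℂ, n - d = N → d - k = K →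
      ∑ s ∈ (Finset.range (K + 1)).filter Even, leftTerm α n (d - s) k =
        ∑ q ∈ (Finset.range (K + 1)).filter Even,
          rightTerm α (n - q / α) (d - q - q / α) (k - q / α) := by
  have le_of_mem {s : ℕ} (hs : s ∈ (Finset.range (K + 1)).filter Even) : s ≤ K :=
    Finset.mem_range_succ_iff.1 (Finset.mem_filter.1 hs).1
  filter_upwards [eventually_codiscrete_eq_of_re_gt
    (Meromorphic.fun_sum (s := (Finset.range (K + 1)).filter Even) fun s hs =>
      meromorphic_leftTerm hα (n := fun k => k + K + N) (m := fun k => k + K - s) (κ := fun k => k)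
      (j := N + s) (i := K - s) (by fun_prop) (by fun_prop) (fun z => by push_cast; ring)
      fun z => by push_cast [le_of_mem hs]; ring)
    (Meromorphic.fun_sum (s := (Finset.range (K + 1)).filter Even) fun q hq =>
      meromorphic_rightTerm hα (n := fun k => k + K + N - q / α) (m := fun k => k + K - q - q / α)
      (κ := fun k => k - q / α) (j := N + q) (i := K - q) (by fun_prop) (by fun_prop)
      (fun z => by push_cast; ring) fun z => by push_cast [le_of_mem hq]; ring)
    fun k hk => sum_leftTerm_eq_of_down_of_re_gt hα (add_sub_cancel_left _ _)
      (add_sub_cancel_left _ _) hk] with k hk n d hn hd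
  obtain rfl : d = k + K := by rw [← hd, add_sub_cancel]
  obtain rfl : n = k + K + N := by rw [← hn, add_sub_cancel]
  exact hk

theorem eventually_sum_leftTerm_eq_of_up (hα : 0 < α) (N K : ℕ) :
    ∀ᶠ k : ℂ in codiscrete ℂ, ∀ n d : ℂ, n - d = N → d - k = K →
      ∑ s ∈ (Finset.Icc 1 N).filter Even, leftTerm α n (d + s) k =
        ∑ q ∈ (Finset.Icc 1 N).filter Even,
          rightTerm α (n + q / α) (d + q + q / α) (k + q / α) := by
  have le_of_mem {s : ℕ} (hs : s ∈ (Finset.Icc 1 N).filter Even) : s ≤ N :=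
    (Finset.mem_Icc.1 (Finset.mem_filter.1 hs).1).2
  filter_upwards [eventually_codiscrete_eq_of_re_gt
    (Meromorphic.fun_sum (s := (Finset.Icc 1 N).filter Even) fun s hs =>
      meromorphic_leftTerm hα (n := fun k => k + K + N) (m := fun k => k + K + s) (κ := fun k => k)
      (j := N - s) (i := K + s) (by fun_prop) (by fun_prop)
      (fun z => by push_cast [le_of_mem hs]; ring) fun z => by push_cast; ring)
    (Meromorphic.fun_sum (s := (Finset.Icc 1 N).filter Even) fun q hq =>
      meromorphic_rightTerm hα (n := fun k => k + K + N + q / α) (m := fun k => k + K + q + q / α)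
      (κ := fun k => k + q / α) (j := N - q) (i := K + q) (by fun_prop) (by fun_prop)
      (fun z => by push_cast [le_of_mem hq]; ring) fun z => by push_cast; ring)
    fun k hk => sum_leftTerm_eq_of_up_of_re_gt hα (add_sub_cancel_left _ _)
      (add_sub_cancel_left _ _) hk] with k hk n d hn hd
  obtain rfl : d = k + K := by rw [← hd, add_sub_cancel]
  obtain rfl : n = k + K + N := by rw [← hn, add_sub_cancel]
  exact hk

end Identities

end BetaPolytope

end

/-- The first two conjuncts say that `A` and `B` really are meromorphic functions extending
their integral formulae; the last one contains the two identities, for `n - d = N` and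
`d - k = K`, as identities of meromorphic functions of `k`, i.e. off a closed discrete set. -/
theorem theorem2p4 (α : ℝ) (hα : 0 < α) :
    (∀ j : ℕ, Meromorphic (fun κ : ℂ => BetaPolytope.A α (κ + j) κ) ∧
      ∀ κ : ℂ, 0 < κ.re → BetaPolytope.A α (κ + j) κ = BetaPolytope.integralA α j κ) ∧
    (∀ j : ℕ, Meromorphic (fun κ : ℂ => BetaPolytope.B α (κ + j) κ) ∧
      ∀ κ : ℂ, -(1 / α) < κ.re → BetaPolytope.B α (κ + j) κ = BetaPolytope.integralB α j κ) ∧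
    ∀ N K : ℕ, ∀ᶠ k : ℂ in Filter.codiscrete ℂ, ∀ n d : ℂ, n - d = N → d - k = K →
      (∑ s ∈ (Finset.range (K + 1)).filter Even,
          BetaPolytope.B α n (d - s) *
            ((d - s + 1 / α) * Complex.Gamma (d - s) / Complex.Gamma (d - s + 1 + 2 / α)) *
            BetaPolytope.A α (d - s + 2 / α) (k + 2 / α)
        = ∑ q ∈ (Finset.range (K + 1)).filter Even,
          BetaPolytope.B α (n - q / α) (d - q - q / α) *
            BetaPolytope.A α (d - q - q / α) (k - q / α)) ∧
      (∑ s ∈ (Finset.Icc 1 N).filter Even,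
          BetaPolytope.B α n (d + s) *
            ((d + s + 1 / α) * Complex.Gamma (d + s) / Complex.Gamma (d + s + 1 + 2 / α)) *
            BetaPolytope.A α (d + s + 2 / α) (k + 2 / α)
        = ∑ q ∈ (Finset.Icc 1 N).filter Even,
          BetaPolytope.B α (n + q / α) (d + q + q / α) *
            BetaPolytope.A α (d + q + q / α) (k + q / α)) := by
  refine ⟨fun j => ⟨?_, ?_⟩, fun j => ⟨?_, ?_⟩, fun N K => ?_⟩
  · exact BetaPolytope.meromorphic_A hα differentiable_id fun κ => add_sub_cancel_left κ _
  · exact fun κ hκ => BetaPolytope.A_eq_integralA hα (add_sub_cancel_left κ _) hκ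
  · exact BetaPolytope.meromorphic_B hα differentiable_id fun κ => add_sub_cancel_left κ _
  · exact fun κ hκ => BetaPolytope.B_eq_integralB hα (add_sub_cancel_left κ _) hκ
  · filter_upwards [BetaPolytope.eventually_sum_leftTerm_eq_of_down hα N K,
      BetaPolytope.eventually_sum_leftTerm_eq_of_up hα N K] with k h_down h_up n d hn hd
    exact ⟨h_down n d hn hd, h_up n d hn hd⟩
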